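/- **Setting.** Let $X=\{x_1,\dots,x_n\}$. A term is a finite set of literals ($x_i$ or $\neg x_i$), no two on the same variable; a DNF $D$ on $X$ is a finite set of terms; it is monotone if no negated literal occurs in it. A model of $D$ is an assignment $\alpha:X\to\{0,1\}$ that satisfies every literal of at least one term of $D$; $\mathsf{sat}(D)$ is the set of models. A DNF with terms listed in any order, without repetition, is given to the machine as a word over a four-letter alphabet: $n$ in unary, then for each term a separator followed by $n$ letters telling, for each variable, whether it is absent, positive or negative. A model is output as the word $\alpha(x_1)\cdots\alpha(x_n)$. **Machine.** A random access machine has registers $R_0,R_1,\dots$ holding natural numbers, initially $0$, and a finite program of the following instructions: load a constant; copy; indirect load and store with a constant displacement, $R_i\leftarrow R_{R_j+c}$ and $R_{R_i+c}\leftarrow R_j$; addition, (truncated) subtraction, multiplication; jump if $R_i\le R_j$; read the next input letter; and output the word formed by the values of a block of consecutive registers. Every instruction takes constant time, except the arithmetic ones, which take time linear in the size of their operands. The space used at a given step is the sum of the numbers of bits of the integers in the registers. **Theorem.** The models of a monotone DNF can be enumerated with average delay $O(n)$ and polynomial space. Precisely, there are one program and constants $C,k$ such that for every $n\ge 0$,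 every monotone DNF $D$ on $n$ variables and every input word $w$ for $D$, the program halts on $w$ after having output each model of $D$ exactly once and nothing else, its space is at every step at most $C(|w|+1)^k$, and 1. if the size of operands is counted in bits, then the run starts with a precomputation phase, during which nothing is output, of time at most $C(|w|+1)^k$, and the rest of the run takes time at most $C\cdot\max(1,n)\cdot\max(1,|\mathsf{sat}(D)|)$; 2. if the size of operands is counted in machine words, whose length is the number of bits of $|w|$, plus one, then the whole run, precomputation included, takes time at most $C\cdot\max(1,n)\cdot\max(1,|\mathsf{sat}(D)|)$. -/

import Mathlib

namespace DNFEnum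

/-! ## DNF formulas over the variables `x_1, …, x_n` (indexed by `Fin n`) -/

/-- A literal: a variable with its sign, `(x, true)` for `x` and `(x, false)` for `¬ x`. -/
abbrev Literal (n : ℕ) : Type := Fin n × Bool

/-- A total assignment of the variables. -/
abbrev Assignment (n : ℕ) : Type := Fin n → Bool

/-- A term: a finite set of literals, two distinct ones having distinct variables. -/
@[ext]
structure Term (n : ℕ) where
  lits : Finset (Literal n)
  consistent : ∀ l ∈ lits, ∀ l' ∈ lits, l.1 = l'.1 → l = l'

/-- A DNF: a finite set of terms. -/
abbrev DNF (n : ℕ) : Type := Finset (Term n)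

/-- `α` gives the value 1 to every literal of `T`. -/
def Term.SatisfiedBy {n : ℕ} (T : Term n) (α : Assignment n) : Prop :=
  ∀ l ∈ T.lits, α l.1 = l.2

/-- The set of models of `D`. -/
def sat {n : ℕ} (D : DNF n) : Set (Assignment n) :=
  {α | ∃ T ∈ D, T.SatisfiedBy α}

/-- No negated literal occurs in `D`. -/
def IsMonotone {n : ℕ} (D : DNF n) : Prop :=
  ∀ T ∈ D, ∀ l ∈ T.lits, l.2 = true

/-! ## Words

Words are lists of letters, letters are positive integers (the value `0` is what a machine reads
after the end of its input). Formulas are written over the four letters `1` (variable absent),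
`2` (positive literal), `3` (negative literal), `4` (start of a term). -/

/-- The word of length `n` describing the sign of each variable in the term. -/
def encodeTerm {n : ℕ} (T : Term n) : List ℕ :=
  List.ofFn fun v : Fin n =>
    if (v, true) ∈ T.lits then 2 else if (v, false) ∈ T.lits then 3 else 1

/-- The input word of a list of terms: `n` in unary, then the terms, each preceded by `4`. -/
def encodeDNF {n : ℕ} (L : List (Term n)) : List ℕ :=
  List.replicate n 1 ++ L.flatMap fun T => 4 :: encodeTerm T

/-- The word `α(x_1) ⋯ α(x_n)`. -/
def encodeModel {n : ℕ} (α : Assignment n) : List ℕ :=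
  List.ofFn fun v : Fin n => if α v then 1 else 0

/-! ## Random access machines -/

/-- Instructions. `R i` is the content of register `i`; `i j k` are fixed register
numbers, `c` is a fixed constant, `l` is a fixed line of the program. -/
inductive Instr : Type
  /-- `R i ← c` -/
  | const (i c : ℕ)
  /-- `R i ← R j` -/
  | copy (i j : ℕ)
  /-- `R i ← R (R j + c)` (indirect access with a fixed displacement) -/
  | load (i j c : ℕ)
  /-- `R (R i + c) ← R j` (indirect access with a fixed displacement) -/
  | store (i c j : ℕ)
  /-- `R i ← R j + R k` -/
  | add (i j k : ℕ)
  /-- `R i ← R j - R k`, or `0` if this is negative -/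
  | sub (i j k : ℕ)
  /-- `R i ← R j * R k` -/
  | mul (i j k : ℕ)
  /-- go to line `l` if `R i ≤ R j`, to the next line otherwise -/
  | jle (i j l : ℕ)
  /-- put the next letter of the input into `R i`, or `0` if the whole input was read -/
  | read (i : ℕ)
  /-- output the word of the values of the registers number `R i`, `R i + 1`, …, `R j` -/
  | output (i j : ℕ)

/-- A program is a finite list of instructions; it halts when it leaves this list. -/
abbrev Program : Type := List Instr

/-- A configuration: current line, registers (all but finitely many are `0`), the part of the
input not read yet, and the words output so far, in order. -/
structure Config : Type where
  pc : ℕ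
  reg : ℕ →₀ ℕ
  input : List ℕ
  outputs : List (List ℕ)

/-- The effect of one instruction. -/
noncomputable def Instr.exec : Instr → Config → Config
  | .const i c, s => { s with pc := s.pc + 1, reg := s.reg.update i c }
  | .copy i j, s => { s with pc := s.pc + 1, reg := s.reg.update i (s.reg j) }
  | .load i j c, s => { s with pc := s.pc + 1, reg := s.reg.update i (s.reg (s.reg j + c)) }
  | .store i c j, s => { s with pc := s.pc + 1, reg := s.reg.update (s.reg i + c) (s.reg j) }
  | .add i j k, s => { s with pc := s.pc + 1, reg := s.reg.update i (s.reg j + s.reg k) }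
  | .sub i j k, s => { s with pc := s.pc + 1, reg := s.reg.update i (s.reg j - s.reg k) }
  | .mul i j k, s => { s with pc := s.pc + 1, reg := s.reg.update i (s.reg j * s.reg k) }
  | .jle i j l, s => { s with pc := if s.reg i ≤ s.reg j then l else s.pc + 1 }
  | .read i, s =>
      { s with pc := s.pc + 1, reg := s.reg.update i (s.input.headD 0), input := s.input.tail }
  | .output i j, s =>
      { s with
        pc := s.pc + 1
        outputs := s.outputs ++ [(List.Ico (s.reg i) (s.reg j + 1)).map fun r => s.reg r] }

/-- The time of one instruction, when the size of an integer is counted in words of `w` bits: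
constant, except for the arithmetic instructions, which take time linear in the size of their
two operands. For `w = 1` sizes are numbers of bits. -/
def Instr.cost (w : ℕ) : Instr → Config → ℕ
  | .add _ j k, s => 1 + (Nat.size (s.reg j) + Nat.size (s.reg k)) / w
  | .sub _ j k, s => 1 + (Nat.size (s.reg j) + Nat.size (s.reg k)) / w
  | .mul _ j k, s => 1 + (Nat.size (s.reg j) + Nat.size (s.reg k)) / w
  | _, _ => 1

/-- The program has halted. -/
def Halted (P : Program) (s : Config) : Prop := P.length ≤ s.pc

/-- One step of the machine; a halted machine does not move. -/
noncomputable def step (P : Program) (s : Config) : Config :=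
  match P[s.pc]? with
  | none => s
  | some ins => ins.exec s

/-- The time of one step. -/
def stepCost (w : ℕ) (P : Program) (s : Config) : ℕ :=
  match P[s.pc]? with
  | none => 0
  | some ins => ins.cost w s

/-- The configuration after `t` steps on input `x`, starting from registers that are all `0`. -/
noncomputable def run (P : Program) (x : List ℕ) (t : ℕ) : Config :=
  (step P)^[t] ⟨0, 0, x, []⟩

/-- The time spent on the steps number `t, …, t' - 1` of the run on input `x`. -/
noncomputable def time (w : ℕ) (P : Program) (x : List ℕ) (t t' : ℕ) : ℕ :=
  ∑ u ∈ Finset.Ico t t', stepCost w P (run P x u)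

/-- The space in use: the total number of bits of the integers in the registers. -/
def Config.space (s : Config) : ℕ := s.reg.sum fun _ v => Nat.size v

/-- On input `x` the machine halts after having output every word of the (finite) set `Y` exactly
once and nothing else, its space is at all times at most `space`, and its average delay is at most
`delay`, in each of the following two senses:
* with sizes counted in bits, after a precomputation phase that takes time at most `prep` and
  outputs nothing, the rest of the run takes time at most `delay` per word of `Y`;
* with sizes counted in machine words (of logarithmically many bits in the length of `x`), the
  whole run, precomputation included, takes time at most `delay` per word of `Y`.
(If `Y` is empty, the times are at most `delay`.) -/
def EnumeratesWithin (P : Program) (x : List ℕ) (Y : Set (List ℕ)) (prep delay space : ℕ) : Prop :=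
  ∃ t₀ t₁ : ℕ, t₀ ≤ t₁ ∧
    Halted P (run P x t₁) ∧
    (run P x t₁).outputs.Nodup ∧ {y | y ∈ (run P x t₁).outputs} = Y ∧
    (run P x t₀).outputs = [] ∧
    time 1 P x 0 t₀ ≤ prep ∧
    time 1 P x t₀ t₁ ≤ delay * max 1 Y.ncard ∧
    time (Nat.size x.length + 1) P x 0 t₁ ≤ delay * max 1 Y.ncard ∧
    ∀ t, (run P x t).space ≤ space

end DNFEnum

/-! A monotone term is the Boolean word of its variables, and its models are the words above it in
the componentwise order. The terms are stored as the leaves of a trie, read from `x_1` at the root.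
The enumeration fixes the variables from `x_n` down to `x_1`. Its state at depth `j` is the set `S`
of nodes of depth `j` that are the remainders of the terms not yet falsified; equal remainders are
one node. Setting the variable above `S` to 1 falsifies nothing, and the new set consists of all
parents. Setting it to 0 keeps only the nodes with letter "absent", and the new set consists of
their parents; if it is empty the branch is dropped. At the root all variables are set, and the
assignment is output. The two branches have disjoint models, so nothing is repeated
(`IsModelList.append`).

Both sets are computed in time `O(|S|)`, marks removing duplicates in the first case. The cost is
paid by one remark: each `w ∈ S`, seen as an assignment, is a model of itself, so `S` has at least
`|S|` models (`IsModelList.length_le`). Each of the `n + 1` levels therefore costs, in total, at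
most a constant per model (`enumerate`).

No separate stack is needed. A list at depth `j` is linked through its own nodes, its head records
the list it came from, and the work below it only writes to nodes of smaller depth. `Frame`
expresses this, and it ensures that a list is intact when control returns to it.

Precomputation takes `O(|w|)` instructions. As there are at most as many terms as models, `|w| + 1`
is `O(max(1,n) · max(1,|sat D|))`. Additions of small constants are the only arithmetic, and occur
only in the precomputation (`Tame`): values stay `O(|w|)`, hence of boundedly many machine words,
space is polynomial, and every later instruction has cost 1. Time thus reduces to counting steps
(`enumeratesWithin_of_steps`). -/

namespace DNFEnum

/-! ## Machine states with functions as registers -/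

/-- A configuration whose registers form a plain function. -/
structure State : Type where
  pc : ℕ
  reg : ℕ → ℕ
  input : List ℕ
  outputs : List (List ℕ)

/-- The effect of one instruction on a state. -/
def Instr.execState : Instr → State → State
  | .const i c, s => { s with pc := s.pc + 1, reg := Function.update s.reg i c }
  | .copy i j, s => { s with pc := s.pc + 1, reg := Function.update s.reg i (s.reg j) }
  | .load i j c, s =>
      { s with pc := s.pc + 1, reg := Function.update s.reg i (s.reg (s.reg j + c)) }
  | .store i c j, s =>
      { s with pc := s.pc + 1, reg := Function.update s.reg (s.reg i + c) (s.reg j) }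
  | .add i j k, s =>
      { s with pc := s.pc + 1, reg := Function.update s.reg i (s.reg j + s.reg k) }
  | .sub i j k, s =>
      { s with pc := s.pc + 1, reg := Function.update s.reg i (s.reg j - s.reg k) }
  | .mul i j k, s =>
      { s with pc := s.pc + 1, reg := Function.update s.reg i (s.reg j * s.reg k) }
  | .jle i j l, s => { s with pc := if s.reg i ≤ s.reg j then l else s.pc + 1 }
  | .read i, s =>
      { s with
        pc := s.pc + 1
        reg := Function.update s.reg i (s.input.headD 0)
        input := s.input.tail }
  | .output i j, s =>
      { s with
        pc := s.pc + 1
        outputs := s.outputs ++ [(List.Ico (s.reg i) (s.reg j + 1)).map s.reg] }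

/-- One step on states. -/
def stepState (P : Program) (s : State) : State :=
  match P[s.pc]? with
  | none => s
  | some ins => ins.execState s

/-- The state of a configuration. -/
def Config.toState (s : Config) : State := ⟨s.pc, s.reg, s.input, s.outputs⟩

theorem toState_step (P : Program) (s : Config) :
    (step P s).toState = stepState P s.toState := by
  unfold step stepState
  rcases h : P[s.pc]? with _ | ins
  · simp [Config.toState, h]
  · cases ins <;>
      (simp [Config.toState, h, Instr.exec, Instr.execState, Finsupp.coe_update]; try congr)

/-- Transfers runs to registers given by plain functions, where `Function.update` computes well;
finite support only matters for the space bound. -/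
theorem toState_run (P : Program) (x : List ℕ) (t : ℕ) :
    (run P x t).toState = (stepState P)^[t] ⟨0, fun _ => 0, x, []⟩ := by
  induction t with
  | zero => rfl
  | succ t ih => rw [run, Function.iterate_succ_apply', Function.iterate_succ_apply', ← ih,
      toState_step, run]

/-- Some state satisfying `Q` is reached from `s` after at most `k` steps. -/
def Within (P : Program) (k : ℕ) (s : State) (Q : State → Prop) : Prop :=
  ∃ t ≤ k, Q ((stepState P)^[t] s)

/-! ### Symbolic execution with step counts -/

section Within

variable {P : Program} {k l pc : ℕ} {f : ℕ → ℕ} {inp : List ℕ} {out : List (List ℕ)}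
  {s : State} {Q R : State → Prop}

theorem Within.done (h : Q s) : Within P k s Q := ⟨0, Nat.zero_le _, h⟩

theorem Within.le (h : Within P k s Q) (hk : k ≤ l) : Within P l s Q := by
  obtain ⟨t, ht, h⟩ := h
  exact ⟨t, ht.trans hk, h⟩

theorem Within.bind (h : Within P k s Q) (hQ : ∀ s, Q s → Within P l s R) :
    Within P (k + l) s R := by
  obtain ⟨t, ht, h⟩ := h
  obtain ⟨t', ht', h'⟩ := hQ _ h
  refine ⟨t' + t, by omega, ?_⟩
  rwa [Function.iterate_add_apply]

theorem Within.step (h : Within P k (stepState P s) Q) : Within P (k + 1) s Q := by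
  obtain ⟨t, ht, h⟩ := h
  exact ⟨t + 1, by omega, h⟩

variable {i j c v : ℕ}

theorem Within.const (h : P[pc]? = some (Instr.const i c))
    (H : Within P k ⟨pc + 1, Function.update f i c, inp, out⟩ Q) :
    Within P (k + 1) ⟨pc, f, inp, out⟩ Q :=
  Within.step (by simpa [stepState, h, Instr.execState] using H)

/-- The value written is supplied by an equation, here and below, so that the register function can
be kept in a chosen normal form. -/
theorem Within.copy (h : P[pc]? = some (Instr.copy i j)) (hv : f j = v)
    (H : Within P k ⟨pc + 1, Function.update f i v, inp, out⟩ Q) :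
    Within P (k + 1) ⟨pc, f, inp, out⟩ Q :=
  Within.step (by simpa [stepState, h, Instr.execState, hv] using H)

theorem Within.load {a : ℕ} (h : P[pc]? = some (Instr.load i j c)) (ha : f j = a) (hv : f (a + c) = v)
    (H : Within P k ⟨pc + 1, Function.update f i v, inp, out⟩ Q) :
    Within P (k + 1) ⟨pc, f, inp, out⟩ Q :=
  Within.step (by simpa [stepState, h, Instr.execState, ha, hv] using H)

theorem Within.store {a : ℕ} (h : P[pc]? = some (Instr.store i c j)) (ha : f i = a) (hv : f j = v)
    (H : Within P k ⟨pc + 1, Function.update f (a + c) v, inp, out⟩ Q) :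
    Within P (k + 1) ⟨pc, f, inp, out⟩ Q :=
  Within.step (by simpa [stepState, h, Instr.execState, ha, hv] using H)

theorem Within.add {m : ℕ} (h : P[pc]? = some (Instr.add i j m)) (hv : f j + f m = v)
    (H : Within P k ⟨pc + 1, Function.update f i v, inp, out⟩ Q) :
    Within P (k + 1) ⟨pc, f, inp, out⟩ Q :=
  Within.step (by simpa [stepState, h, Instr.execState, hv] using H)

theorem Within.jump {l : ℕ} (h : P[pc]? = some (Instr.jle i j l)) (hv : f i ≤ f j)
    (H : Within P k ⟨l, f, inp, out⟩ Q) : Within P (k + 1) ⟨pc, f, inp, out⟩ Q :=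
  Within.step (by simpa [stepState, h, Instr.execState, hv] using H)

theorem Within.noJump {l : ℕ} (h : P[pc]? = some (Instr.jle i j l)) (hv : f j < f i)
    (H : Within P k ⟨pc + 1, f, inp, out⟩ Q) : Within P (k + 1) ⟨pc, f, inp, out⟩ Q :=
  Within.step (by simpa [stepState, h, Instr.execState, hv.not_ge] using H)

theorem Within.read (h : P[pc]? = some (Instr.read i))
    (H : Within P k ⟨pc + 1, Function.update f i (inp.headD 0), inp.tail, out⟩ Q) :
    Within P (k + 1) ⟨pc, f, inp, out⟩ Q :=
  Within.step (by simpa [stepState, h, Instr.execState] using H)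

theorem Within.output (h : P[pc]? = some (Instr.output i j))
    (H : Within P k ⟨pc + 1, f, inp, out ++ [(List.Ico (f i) (f j + 1)).map f]⟩ Q) :
    Within P (k + 1) ⟨pc, f, inp, out⟩ Q :=
  Within.step (by simpa [stepState, h, Instr.execState] using H)

end Within

/-! ## Bounds on time and space from a syntactic check -/

/-- All constants are at most `16`; the only arithmetic instructions are additions, occur before
line `p`, and have as last operand a constant at most `8` loaded by the previous line; no jump leads
to an addition or back from line `p` on to a line before `p`. -/
structure Tame (P : Program) (p : ℕ) : Prop where
  const : ∀ l i c : ℕ, P[l]? = some (Instr.const i c) → i ≤ 16 ∧ c ≤ 16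
  dest : ∀ l i j : ℕ, P[l]? = some (Instr.copy i j) → i ≤ 16
  load : ∀ l i j c : ℕ, P[l]? = some (Instr.load i j c) → i ≤ 16
  store : ∀ l i c j : ℕ, P[l]? = some (Instr.store i c j) → c ≤ 16
  read : ∀ l i : ℕ, P[l]? = some (Instr.read i) → i ≤ 16
  add : ∀ l i j k : ℕ, P[l]? = some (Instr.add i j k) → i ≤ 16 ∧ l < p
  sub : ∀ l i j k : ℕ, P[l]? ≠ some (Instr.sub i j k)
  mul : ∀ l i j k : ℕ, P[l]? ≠ some (Instr.mul i j k)
  start : ∀ i j k : ℕ, P[0]? ≠ some (Instr.add i j k)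
  pred : ∀ l i j k : ℕ, P[l + 1]? = some (Instr.add i j k) → ∃ c ≤ 8, P[l]? = some (Instr.const k c)
  jump : ∀ l i j m : ℕ, P[l]? = some (Instr.jle i j m) →
    (p ≤ l → p ≤ m) ∧ ∀ i j k : ℕ, P[m]? ≠ some (Instr.add i j k)

/-- Register values are at most `V`, registers after `V + 16` are not used, and a constant about to
be added is at most `8`. -/
structure Bounded (P : Program) (V : ℕ) (s : State) : Prop where
  le : ∀ a, s.reg a ≤ V
  unused : ∀ a, V + 16 < a → s.reg a = 0
  input : ∀ c ∈ s.input, c ≤ V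
  operand : ∀ i j k : ℕ, P[s.pc]? = some (Instr.add i j k) → s.reg k ≤ 8

/-- Only an addition creates a value above the bound. It adds at most 8 and is possible only before
line `p`, so from there on the bound no longer grows. -/
theorem Bounded.step {P : Program} {p V V' : ℕ} {s : State} (hP : Tame P p)
    (h : Bounded P V s) (hV : 16 ≤ V) (hV' : V ≤ V') (hp : s.pc < p → V + 8 ≤ V') :
    Bounded P V' (stepState P s) := by
  have hle : ∀ a, s.reg a ≤ V' := fun a => (h.le a).trans hV'
  have hun : ∀ a, V' + 16 < a → s.reg a = 0 := fun a ha => h.unused a (by omega)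
  have hin : ∀ c ∈ s.input, c ≤ V' := fun c hc => (h.input c hc).trans hV'
  have upd : ∀ a v, a ≤ V' + 16 → v ≤ V' → (∀ b, Function.update s.reg a v b ≤ V') ∧
      ∀ b, V' + 16 < b → Function.update s.reg a v b = 0 := by
    refine fun a v ha hv => ⟨fun b => ?_, fun b hb => ?_⟩
    · rw [Function.update_apply]; split_ifs; exacts [hv, hle b]
    · rw [Function.update_of_ne (by omega)]; exact hun b hb
  -- An addition directly follows the load of its constant, so after any other instruction the
  -- operand condition is vacuous.
  have nxt : (∀ i c : ℕ, P[s.pc]? ≠ some (Instr.const i c)) → ∀ i j k, P[s.pc + 1]? ≠ some (Instr.add i j k) := by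
    intro hc i j k he
    obtain ⟨c, -, hc'⟩ := hP.pred _ _ _ _ he
    exact hc _ _ hc'
  unfold stepState
  rcases e : P[s.pc]? with _ | ins
  · exact ⟨hle, hun, hin, h.operand⟩
  · cases ins with
    | const i c =>
      obtain ⟨h1, h2⟩ := upd i c (by have := hP.const _ _ _ e; omega)
        (by have := hP.const _ _ _ e; omega)
      refine ⟨h1, h2, hin, fun i' j' k' he => ?_⟩
      obtain ⟨c', hc, hc'⟩ := hP.pred _ _ _ _ he
      rw [e] at hc'
      obtain ⟨rfl, rfl⟩ : i = k' ∧ c = c' := by simpa using hc'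
      simpa [Instr.execState] using hc
    | copy i j =>
      obtain ⟨h1, h2⟩ := upd i (s.reg j) (by have := hP.dest _ _ _ e; omega) (hle _)
      exact ⟨h1, h2, hin, fun i' j' k' he => absurd he (nxt (by simp [e]) _ _ _)⟩
    | load i j c =>
      obtain ⟨h1, h2⟩ := upd i (s.reg (s.reg j + c)) (by have := hP.load _ _ _ _ e; omega) (hle _)
      exact ⟨h1, h2, hin, fun i' j' k' he => absurd he (nxt (by simp [e]) _ _ _)⟩
    | store i c j =>
      obtain ⟨h1, h2⟩ := upd (s.reg i + c) (s.reg j)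
        (by have := hP.store _ _ _ _ e; have := hle i; omega) (hle _)
      exact ⟨h1, h2, hin, fun i' j' k' he => absurd he (nxt (by simp [e]) _ _ _)⟩
    | add i j k =>
      obtain ⟨h1, h2⟩ := upd i (s.reg j + s.reg k) (by have := hP.add _ _ _ _ e; omega)
        (by have := hp (hP.add _ _ _ _ e).2; have := h.le j; have := h.operand _ _ _ e; omega)
      exact ⟨h1, h2, hin, fun i' j' k' he => absurd he (nxt (by simp [e]) _ _ _)⟩
    | sub i j k => exact absurd e (hP.sub _ _ _ _)
    | mul i j k => exact absurd e (hP.mul _ _ _ _)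
    | jle i j m =>
      refine ⟨hle, hun, hin, fun i' j' k' he => ?_⟩
      simp only [Instr.execState] at he
      split_ifs at he
      · exact absurd he ((hP.jump _ _ _ _ e).2 _ _ _)
      · exact absurd he (nxt (by simp [e]) _ _ _)
    | read i =>
      obtain ⟨h1, h2⟩ := upd i (s.input.headD 0) (by have := hP.read _ _ e; omega)
        (by
          rcases hx : s.input with _ | ⟨c, l⟩
          · simp
          · exact hin c (by simp [hx]))
      exact ⟨h1, h2, fun c hc => hin c (List.mem_of_mem_tail hc),
        fun i' j' k' he => absurd he (nxt (by simp [e]) _ _ _)⟩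
    | output i j =>
      exact ⟨hle, hun, hin, fun i' j' k' he => absurd he (nxt (by simp [e]) _ _ _)⟩

theorem Tame.le_pc_step {P : Program} {p : ℕ} {s : State} (hP : Tame P p) (h : p ≤ s.pc) :
    p ≤ (stepState P s).pc := by
  unfold stepState
  rcases e : P[s.pc]? with _ | ins
  · exact h
  · cases ins with
    | jle i j m =>
      simp only [Instr.execState]
      split_ifs
      · exact (hP.jump _ _ _ _ e).1 h
      · omega
    | _ => simp only [Instr.execState]; omega

/-! ### Time and space of whole runs -/

section Run

variable {P : Program} {p : ℕ} {x : List ℕ}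

theorem bounded_run (hP : Tame P p) (hx : ∀ c ∈ x, c ≤ 16) (t : ℕ) :
    Bounded P (16 + 8 * t) (run P x t).toState := by
  induction t with
  | zero =>
    rw [toState_run]
    exact ⟨by simp, by simp, fun c hc => by simpa using hx c hc,
      fun i j k h => absurd h (hP.start _ _ _)⟩
  | succ t ih =>
    rw [toState_run, Function.iterate_succ_apply', ← toState_run]
    exact ih.step hP (by omega) (by omega) (by omega)

theorem le_pc_run {t₀ : ℕ} (hP : Tame P p) (h₀ : p ≤ (run P x t₀).pc) (t : ℕ) :
    p ≤ (run P x (t₀ + t)).pc := by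
  induction t with
  | zero => exact h₀
  | succ t ih =>
    change p ≤ (run P x (t₀ + t + 1)).toState.pc
    rw [toState_run, Function.iterate_succ_apply', ← toState_run]
    exact hP.le_pc_step ih

/-- Past line `p` no addition is executed, so the bound is frozen at its value at time `t₀`. -/
theorem bounded_run_add {t₀ : ℕ} (hP : Tame P p) (hx : ∀ c ∈ x, c ≤ 16)
    (h₀ : p ≤ (run P x t₀).pc) (t : ℕ) :
    Bounded P (16 + 8 * t₀) (run P x (t₀ + t)).toState := by
  induction t with
  | zero => exact bounded_run hP hx t₀
  | succ t ih =>
    have := le_pc_run hP h₀ t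
    rw [← add_assoc, toState_run, Function.iterate_succ_apply', ← toState_run]
    exact ih.step hP (by omega) le_rfl (fun h => absurd this h.not_ge)

theorem bounded_run_all {t₀ : ℕ} (hP : Tame P p) (hx : ∀ c ∈ x, c ≤ 16)
    (h₀ : p ≤ (run P x t₀).pc) (t : ℕ) :
    ∃ V ≤ 16 + 8 * t₀, Bounded P V (run P x t).toState := by
  rcases le_total t t₀ with h | h
  · exact ⟨_, by omega, bounded_run hP hx t⟩
  · obtain ⟨d, rfl⟩ := Nat.exists_eq_add_of_le h
    exact ⟨_, le_rfl, bounded_run_add hP hx h₀ d⟩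

/-- A number has at most as many bits as its value; this crude estimate is enough for polynomial
space. -/
theorem space_le {V : ℕ} {s : Config} (h : Bounded P V s.toState) :
    s.space ≤ (V + 17) * V := by
  have hs : s.reg.support ⊆ Finset.range (V + 17) := by
    intro a ha
    by_contra hc
    rw [Finset.mem_range, not_lt] at hc
    exact Finsupp.mem_support_iff.1 ha (h.unused a (by omega))
  calc s.space = ∑ a ∈ s.reg.support, Nat.size (s.reg a) := rfl
    _ ≤ ∑ a ∈ Finset.range (V + 17), Nat.size (s.reg a) :=
        Finset.sum_le_sum_of_subset hs
    _ ≤ ∑ _a ∈ Finset.range (V + 17), V :=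
        Finset.sum_le_sum fun a _ =>
          (Nat.size_le.2 (Nat.lt_two_pow_self.trans_le
            (Nat.pow_le_pow_right two_pos le_rfl))).trans (h.le a)
    _ = (V + 17) * V := by simp

theorem stepCost_le {w V : ℕ} {s : Config} (h : Bounded P V s.toState) :
    stepCost w P s ≤ 1 + 2 * Nat.size V / w := by
  have hb : ∀ a b, 1 + (Nat.size (s.reg a) + Nat.size (s.reg b)) / w ≤ 1 + 2 * Nat.size V / w := by
    intro a b
    have h1 := Nat.size_le_size (h.le a)
    have h2 := Nat.size_le_size (h.le b)
    have : Nat.size (s.reg a) + Nat.size (s.reg b) ≤ 2 * Nat.size V := by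
      change Nat.size (s.reg a) ≤ _ at h1
      change Nat.size (s.reg b) ≤ _ at h2
      omega
    exact Nat.add_le_add_left (Nat.div_le_div_right this) 1
  unfold stepCost
  rcases P[s.pc]? with _ | ins
  · exact Nat.zero_le _
  · cases ins <;> first | exact hb _ _ | exact Nat.le_add_right _ _

theorem stepCost_le_one {w : ℕ} {s : Config} (hP : Tame P p) (h : p ≤ s.pc) :
    stepCost w P s ≤ 1 := by
  unfold stepCost
  rcases e : P[s.pc]? with _ | ins
  · exact Nat.zero_le _
  · cases ins with
    | add i j k => exact absurd (hP.add _ _ _ _ e).2 h.not_gt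
    | sub i j k => exact absurd e (hP.sub _ _ _ _)
    | mul i j k => exact absurd e (hP.mul _ _ _ _)
    | _ => exact le_rfl

theorem time_prefix_le (w : ℕ) {t₀ : ℕ} (hP : Tame P p) (hx : ∀ c ∈ x, c ≤ 16) :
    time w P x 0 t₀ ≤ t₀ * (1 + 2 * Nat.size (16 + 8 * t₀) / w) := by
  calc time w P x 0 t₀ ≤ ∑ _u ∈ Finset.Ico 0 t₀, (1 + 2 * Nat.size (16 + 8 * t₀) / w) := by
        refine Finset.sum_le_sum fun u hu => (stepCost_le (bounded_run hP hx u)).trans ?_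
        have : u < t₀ := (Finset.mem_Ico.1 hu).2
        gcongr
        exact Nat.size_le_size (by omega)
    _ = _ := by simp

theorem time_suffix_le (w : ℕ) {t₀ t₁ : ℕ} (hP : Tame P p) (h₀ : p ≤ (run P x t₀).pc) :
    time w P x t₀ t₁ ≤ t₁ - t₀ := by
  calc time w P x t₀ t₁ ≤ ∑ _u ∈ Finset.Ico t₀ t₁, 1 := by
        refine Finset.sum_le_sum fun u hu => ?_
        obtain ⟨d, rfl⟩ := Nat.exists_eq_add_of_le (Finset.mem_Ico.1 hu).1
        exact stepCost_le_one hP (le_pc_run hP h₀ d)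
    _ = _ := by simp

theorem size_mul_le (a b : ℕ) : Nat.size (a * b) ≤ Nat.size a + Nat.size b := by
  rw [Nat.size_le, pow_add]
  exact Nat.mul_lt_mul'' (Nat.lt_size_self a) (Nat.lt_size_self b)

theorem size_succ_le (a : ℕ) : Nat.size (a + 1) ≤ Nat.size a + 1 := by
  rw [Nat.size_le, pow_succ]
  have := Nat.lt_size_self a
  omega

/-- Enumeration within linear precomputation and delay `n`, read off from numbers of steps. -/
theorem enumeratesWithin_of_steps (hP : Tame P p) (hx : ∀ c ∈ x, c ≤ 16) {Y : Set (List ℕ)}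
    {A C N t₀ t₁ : ℕ} (hA : 16 ≤ A) (ht : t₀ ≤ t₁) (h₀ : p ≤ (run P x t₀).pc)
    (hout : (run P x t₀).outputs = []) (hhalt : Halted P (run P x t₁))
    (hnodup : (run P x t₁).outputs.Nodup) (hY : {y | y ∈ (run P x t₁).outputs} = Y)
    (ht₀ : t₀ ≤ A * (x.length + 1)) (hlen : x.length + 1 ≤ C * (N * max 1 Y.ncard))
    (ht₁ : t₁ - t₀ ≤ C * (N * max 1 Y.ncard))
    {K : ℕ} (hK : K = 2000 * A ^ 2 * (C + 1)) :
    EnumeratesWithin P x Y (K * (x.length + 1) ^ 2) (K * N) (K * (x.length + 1) ^ 2) := by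
  set M := x.length + 1 with hM
  have hM1 : 1 ≤ M := by omega
  -- Since `A ≥ 16`, the constant 16 is absorbed by one more `A * M`.
  have hV : 16 + 8 * t₀ ≤ 9 * A * M := by nlinarith
  have hA2 : A ≤ A ^ 2 := by nlinarith
  have hsmall : C * (N * max 1 Y.ncard) ≤ K * N * max 1 Y.ncard := by
    have : C ≤ K := by rw [hK]; nlinarith
    calc C * (N * max 1 Y.ncard) ≤ K * (N * max 1 Y.ncard) := Nat.mul_le_mul_right _ this
      _ = _ := by ring
  refine ⟨t₀, t₁, ht, hhalt, hnodup, hY, hout, ?_, ?_, ?_, ?_⟩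
  · refine (time_prefix_le 1 hP hx).trans ?_
    have h1 : Nat.size (16 + 8 * t₀) ≤ 9 * A * M :=
      (Nat.size_le.2 Nat.lt_two_pow_self).trans hV
    have h2 : 1 + 2 * Nat.size (16 + 8 * t₀) / 1 ≤ 19 * A * M := by
      rw [Nat.div_one]
      nlinarith
    calc t₀ * (1 + 2 * Nat.size (16 + 8 * t₀) / 1) ≤ (A * M) * (19 * A * M) :=
          Nat.mul_le_mul ht₀ h2
      _ = (19 * A ^ 2) * M ^ 2 := by ring
      _ ≤ K * M ^ 2 := Nat.mul_le_mul_right _ (by rw [hK]; nlinarith)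
  · exact (time_suffix_le 1 hP h₀).trans (ht₁.trans hsmall)
  · have hsplit : time (Nat.size x.length + 1) P x 0 t₁
        = time (Nat.size x.length + 1) P x 0 t₀ + time (Nat.size x.length + 1) P x t₀ t₁ :=
      (Finset.sum_Ico_consecutive _ (Nat.zero_le _) ht).symm
    -- Register values are linear in the input length, so they exceed one machine word by a bounded
    -- number of bits, and an addition costs `O(1)` in words.
    have h1 : Nat.size (16 + 8 * t₀) ≤ 9 * A + Nat.size x.length + 1 := by
      have e1 : Nat.size (16 + 8 * t₀) ≤ Nat.size (9 * A * M) := Nat.size_le_size hV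
      have e2 := size_mul_le (9 * A) M
      have e3 : Nat.size (9 * A) ≤ 9 * A := Nat.size_le.2 Nat.lt_two_pow_self
      have e4 : Nat.size M ≤ Nat.size x.length + 1 := size_succ_le _
      omega
    have h2 : 1 + 2 * Nat.size (16 + 8 * t₀) / (Nat.size x.length + 1) ≤ 19 * A := by
      have : 2 * Nat.size (16 + 8 * t₀) / (Nat.size x.length + 1) ≤ 18 * A + 2 := by
        refine Nat.div_le_of_le_mul ?_
        nlinarith [Nat.zero_le (Nat.size x.length * A)]
      omega
    -- The precomputation is charged to the models through `hlen`, which bounds the input length by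
    -- their number.
    have h3 : time (Nat.size x.length + 1) P x 0 t₀ ≤ 19 * A ^ 2 * C * (N * max 1 Y.ncard) :=
      calc time (Nat.size x.length + 1) P x 0 t₀
          ≤ t₀ * (1 + 2 * Nat.size (16 + 8 * t₀) / (Nat.size x.length + 1)) :=
            time_prefix_le _ hP hx
        _ ≤ (A * M) * (19 * A) := Nat.mul_le_mul ht₀ h2
        _ = 19 * A ^ 2 * M := by ring
        _ ≤ 19 * A ^ 2 * (C * (N * max 1 Y.ncard)) := Nat.mul_le_mul_left _ hlen
        _ = _ := by ring
    have h4 := (time_suffix_le (Nat.size x.length + 1) (t₁ := t₁) hP h₀).trans ht₁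
    rw [hsplit]
    calc _ ≤ (19 * A ^ 2 * C + C) * (N * max 1 Y.ncard) := by
          rw [add_mul]; exact add_le_add h3 h4
      _ ≤ K * (N * max 1 Y.ncard) := Nat.mul_le_mul_right _ (by
          rw [hK]
          have : C ≤ A ^ 2 * C := Nat.le_mul_of_pos_left _ (by positivity)
          nlinarith)
      _ = _ := by ring
  · intro t
    obtain ⟨V, hV', hb⟩ := bounded_run_all hP hx h₀ t
    have h1 : V ≤ 9 * A * M := hV'.trans hV
    have h2 : V + 17 ≤ 27 * A * M := by nlinarith
    calc (run P x t).space ≤ (V + 17) * V := space_le hb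
      _ ≤ (27 * A * M) * (9 * A * M) := Nat.mul_le_mul h2 h1
      _ = (243 * A ^ 2) * M ^ 2 := by ring
      _ ≤ K * M ^ 2 := Nat.mul_le_mul_right _ (by rw [hK]; nlinarith)

end Run

/-! ## The program -/

/-- The lines `0` to `39` read the input and store its terms in a trie; the others enumerate. -/
def prog : Program :=
  -- Registers 0 and 1 hold 0 and 1; 4 and 5 the addresses of the first and last variable; 6 the
  -- separator letter; 7 and 8 the root and the first free address; 13 the head of the current list
  -- and 14 that of the list being built. Null pointers are 0, so comparison with register 1 tests
  -- for them; `jle 0 0` always jumps.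
  [.const 1 1, .const 6 4, .const 4 16, .const 5 15,
   .read 3, .jle 6 3 10, .jle 3 0 40, .const 2 1, .add 5 5 2, .jle 0 0 4,
   .const 2 1, .add 7 5 2, .const 2 8, .add 8 7 2,
   .copy 9 7, .copy 10 4,
   -- Walk down the trie along one word, creating missing children, then link the leaf into the list
   -- of terms.
   .jle 10 5 18, .jle 0 0 36,
   .read 3, .copy 11 9, .jle 3 1 23, .const 2 1, .add 11 9 2, .load 12 11 6, .jle 1 12 32,
   .copy 12 8, .store 11 6 12, .store 12 0 9, .store 12 1 3, .store 12 4 10, .const 2 8, .add 8 8 2,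
   .copy 9 12, .const 2 1, .add 10 10 2, .jle 0 0 16,
   .store 9 2 13, .copy 13 9, .read 3, .jle 6 3 14,
   .jle 13 0 81,
   -- Unless the root is reached, set the variable to 1 and collect the parents of all nodes, each
   -- once, using marks that are then cleared.
   .load 12 13 0, .jle 12 0 60, .load 11 13 4, .store 11 0 1, .copy 14 0, .copy 9 13,
   .load 12 9 0, .load 2 12 3, .jle 1 2 53, .store 12 3 1, .store 12 2 14, .copy 14 12,
   .load 9 9 2, .jle 1 9 47,
   .copy 9 14, .store 9 3 0, .load 9 9 2, .jle 1 9 56, .jle 0 0 78,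
   .output 4 5,
   -- The current list is finished: return to the one it came from. If its variable is 0, that list
   -- is finished too; if it is 1, the branch 0 follows.
   .load 13 13 5, .jle 13 0 81, .load 11 13 4, .load 12 11 0, .jle 12 0 61,
   .store 11 0 0, .copy 14 0, .copy 9 13,
   .load 2 9 1, .jle 2 1 72, .jle 0 0 75, .load 12 9 0, .store 12 2 14, .copy 14 12,
   .load 9 9 2, .jle 1 9 69, .jle 14 0 61,
   .store 14 5 13, .copy 13 14, .jle 0 0 41]

/-- A line of the program satisfies the conditions of `Tame`. -/
def Instr.isTame (P : Program) (p l : ℕ) : Instr → Bool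
  | .const i c => i ≤ 16 && c ≤ 16
  | .copy i _ => i ≤ 16
  | .load i _ _ => i ≤ 16
  | .store _ c _ => c ≤ 16
  | .read i => i ≤ 16
  | .add i _ k => i ≤ 16 && l < p && 0 < l &&
      match P[l - 1]? with
      | some (.const i c) => i == k && c ≤ 8
      | _ => false
  | .sub _ _ _ => false
  | .mul _ _ _ => false
  | .jle _ _ m => (l < p || p ≤ m) &&
      match P[m]? with
      | some (.add _ _ _) => false
      | _ => true
  | .output _ _ => true

/-- Replaces the quantifiers of `Tame` by a check of each instruction, which `decide` can run. -/
theorem tame_of_isTame {P : Program} {p : ℕ}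
    (h : ∀ l < P.length, ∀ ins ∈ P[l]?, ins.isTame P p l = true) : Tame P p := by
  have H : ∀ (l : ℕ) (ins : Instr), P[l]? = some ins → ins.isTame P p l = true := fun l ins e =>
    h l (by by_contra hc; rw [List.getElem?_eq_none (by omega)] at e; simp at e) ins e
  constructor
  · intro l i c e; simpa [Instr.isTame] using H _ _ e
  · intro l i c e; simpa [Instr.isTame] using H _ _ e
  · intro l i j c e; simpa [Instr.isTame] using H _ _ e
  · intro l i j c e; simpa [Instr.isTame] using H _ _ e
  · intro l i e; simpa [Instr.isTame] using H _ _ e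
  · intro l i j k e
    have := H _ _ e
    simp only [Instr.isTame, Bool.and_eq_true, decide_eq_true_eq] at this
    exact this.1.1
  · intro l i j k e; simpa [Instr.isTame] using H _ _ e
  · intro l i j k e; simpa [Instr.isTame] using H _ _ e
  · intro i j k e; simpa [Instr.isTame] using H _ _ e
  · intro l i j k e
    have := H _ _ e
    simp only [Instr.isTame, Bool.and_eq_true, decide_eq_true_eq, Nat.add_sub_cancel] at this
    have := this.2
    split at this
    · next i' c e' =>
        simp only [Bool.and_eq_true, beq_iff_eq, decide_eq_true_eq] at this
        exact ⟨c, this.2, by rw [e', this.1]⟩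
    · simp at this
  · intro l i j m e
    have := H _ _ e
    simp only [Instr.isTame, Bool.and_eq_true, Bool.or_eq_true, decide_eq_true_eq] at this
    refine ⟨fun hl => by omega, fun i' j' k' e' => ?_⟩
    simp [e'] at this

theorem tame_prog : Tame prog 40 := tame_of_isTame (by decide)

/-! ## The trie in memory -/

/-- The letter for a variable that is absent from or present in a term. -/
def letter (b : Bool) : ℕ := if b then 2 else 1

/-- The value of a Boolean in a register. -/
def bit (b : Bool) : ℕ := if b then 1 else 0

/-- The address of the node of the word `w`; words are in reverse order, so that `b :: w` is a child
of `w`. A node has eight registers: parent, letter, next node in a list, mark, address of the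
variable, list that it comes from, and the two children. -/
def addr (n : ℕ) (W : List (List Bool)) (w : List Bool) : ℕ := 16 + n + 8 * W.idxOf w

/-- The address of the first node of a list, `0` for the empty list. -/
def headAddr (n : ℕ) (W : List (List Bool)) : List (List Bool) → ℕ
  | [] => 0
  | w :: _ => addr n W w

/-- The nodes of the list are linked in memory. -/
def IsChain (n : ℕ) (W : List (List Bool)) (f : ℕ → ℕ) : List (List Bool) → Prop
  | [] => True
  | w :: S => f (addr n W w + 2) = headAddr n W S ∧ IsChain n W f S

/-- A set of words closed under taking parents. -/
structure IsTrie (W : List (List Bool)) : Prop where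
  nil : [] ∈ W
  parent : ∀ b w, b :: w ∈ W → w ∈ W

/-- The contents of the registers that do not change during the enumeration. -/
structure Static (n : ℕ) (W : List (List Bool)) (f : ℕ → ℕ) : Prop where
  zero : f 0 = 0
  one : f 1 = 1
  first : f 4 = 16
  last : f 5 = 15 + n
  root : f (addr n W []) = 0
  parent : ∀ b w, b :: w ∈ W → f (addr n W (b :: w)) = addr n W w
  letter : ∀ b w, b :: w ∈ W → f (addr n W (b :: w) + 1) = letter b
  var : ∀ b w, b :: w ∈ W → f (addr n W (b :: w) + 4) = 16 + w.length

/-- `g` differs from `f` at most on the temporary registers, on the first `i` variables, and on the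
lists of nodes of depth less than `k`. -/
def Frame (n : ℕ) (W : List (List Bool)) (i k : ℕ) (f g : ℕ → ℕ) : Prop :=
  ∀ a, a ≠ 2 → a ≠ 9 → a ≠ 11 → a ≠ 12 → a ≠ 13 → a ≠ 14 → (a < 16 ∨ 16 + i ≤ a) →
    (∀ w ∈ W, w.length < k →
      a ≠ addr n W w + 2 ∧ a ≠ addr n W w + 3 ∧ a ≠ addr n W w + 5) → g a = f a

/-! ### Disjointness of node blocks, and what a frame preserves -/

section Memory

variable {n : ℕ} {W : List (List Bool)} {i k : ℕ} {f g h : ℕ → ℕ}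

theorem le_addr (w : List Bool) : 16 + n ≤ addr n W w := Nat.le_add_right _ _

theorem exists_addr (w : List Bool) : ∃ a, addr n W w = 16 + n + 8 * a := ⟨_, rfl⟩

theorem addr_eq_iff {v w : List Bool} (hw : w ∈ W) :
    addr n W w = addr n W v ↔ w = v := by
  constructor
  · intro h
    have : W.idxOf w = W.idxOf v := by unfold addr at h; omega
    exact (List.idxOf_inj hw).1 this
  · rintro rfl; rfl

/-- Distinct nodes occupy disjoint blocks of eight registers. -/
theorem addr_add_ne {v w : List Bool} {c d : ℕ} (hw : w ∈ W) (hne : w ≠ v) (hc : c < 8)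
    (hd : d < 8) : addr n W w + c ≠ addr n W v + d := by
  have := mt (addr_eq_iff (n := n) (v := v) hw).1 hne
  obtain ⟨a, ha⟩ := exists_addr (n := n) (W := W) w
  obtain ⟨b, hb⟩ := exists_addr (n := n) (W := W) v
  omega

theorem addr_add_ne_of_ne {v w : List Bool} {c d : ℕ} (hne : c ≠ d) (hc : c < 8)
    (hd : d < 8) : addr n W w + c ≠ addr n W v + d := by
  obtain ⟨a, ha⟩ := exists_addr (n := n) (W := W) w
  obtain ⟨b, hb⟩ := exists_addr (n := n) (W := W) v
  omega

theorem headAddr_pos {S : List (List Bool)} (hS : S ≠ []) : 16 ≤ headAddr n W S := by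
  rcases S with _ | ⟨w, S⟩
  · exact absurd rfl hS
  · have := le_addr (n := n) (W := W) w
    simp only [headAddr]
    omega

theorem IsChain.congr {S : List (List Bool)} (h : IsChain n W f S)
    (hfg : ∀ w ∈ S, g (addr n W w + 2) = f (addr n W w + 2)) : IsChain n W g S := by
  induction S with
  | nil => trivial
  | cons w S ih =>
    exact ⟨(hfg w (by simp)).trans h.1, ih h.2 fun v hv => hfg v (by simp [hv])⟩

theorem Frame.refl : Frame n W i k f f := fun _ _ _ _ _ _ _ _ _ => rfl

theorem Frame.trans (h₁ : Frame n W i k f g) (h₂ : Frame n W i k g h) : Frame n W i k f h :=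
  fun a p₁ p₂ p₃ p₄ p₅ p₆ p₇ p₈ =>
    (h₂ a p₁ p₂ p₃ p₄ p₅ p₆ p₇ p₈).trans (h₁ a p₁ p₂ p₃ p₄ p₅ p₆ p₇ p₈)

theorem Frame.mono {i' k' : ℕ} (h : Frame n W i k f g) (hi : i ≤ i') (hk : k ≤ k') :
    Frame n W i' k' f g :=
  fun a p₁ p₂ p₃ p₄ p₅ p₆ p₇ p₈ =>
    h a p₁ p₂ p₃ p₄ p₅ p₆ (by omega) fun w hw hl => p₈ w hw (by omega)

theorem Frame.update {a : ℕ} (h : Frame n W i k f g) (v : ℕ)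
    (ha : a = 2 ∨ a = 9 ∨ a = 11 ∨ a = 12 ∨ a = 13 ∨ a = 14) :
    Frame n W i k f (Function.update g a v) := by
  intro b p₁ p₂ p₃ p₄ p₅ p₆ p₇ p₈
  rw [Function.update_of_ne (by omega)]
  exact h b p₁ p₂ p₃ p₄ p₅ p₆ p₇ p₈

theorem Frame.update_var {a : ℕ} (h : Frame n W i k f g) (v : ℕ) (ha : 16 ≤ a) (hi : a < 16 + i) :
    Frame n W i k f (Function.update g a v) := by
  intro b p₁ p₂ p₃ p₄ p₅ p₆ p₇ p₈
  rw [Function.update_of_ne (by omega)]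
  exact h b p₁ p₂ p₃ p₄ p₅ p₆ p₇ p₈

theorem Frame.update_node {w : List Bool} {c : ℕ} (h : Frame n W i k f g) (v : ℕ) (hw : w ∈ W)
    (hk : w.length < k) (hc : c = 2 ∨ c = 3 ∨ c = 5) :
    Frame n W i k f (Function.update g (addr n W w + c) v) := by
  intro b p₁ p₂ p₃ p₄ p₅ p₆ p₇ p₈
  have := p₈ w hw hk
  rw [Function.update_of_ne (by rcases hc with rfl | rfl | rfl <;> omega)]
  exact h b p₁ p₂ p₃ p₄ p₅ p₆ p₇ p₈

theorem Frame.reg {a : ℕ} (h : Frame n W i k f g)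
    (ha : a = 0 ∨ a = 1 ∨ a = 4 ∨ a = 5) : g a = f a :=
  h a (by omega) (by omega) (by omega) (by omega) (by omega) (by omega) (by omega) fun w _ _ => by
    have := le_addr (n := n) (W := W) w
    omega

theorem Frame.var {j : ℕ} (h : Frame n W i k f g) (hj : i ≤ j) (hn : j < n) :
    g (16 + j) = f (16 + j) :=
  h _ (by omega) (by omega) (by omega) (by omega) (by omega) (by omega) (by omega) fun w _ _ => by
    have := le_addr (n := n) (W := W) w
    omega

/-- Parent, letter and variable are never rewritten, whatever the depth of the node. -/
theorem Frame.field {w : List Bool} {c : ℕ} (h : Frame n W i k f g) (hi : i ≤ n)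
    (hc : c = 0 ∨ c = 1 ∨ c = 4) : g (addr n W w + c) = f (addr n W w + c) := by
  have := le_addr (n := n) (W := W) w
  refine h _ (by omega) (by omega) (by omega) (by omega) (by omega) (by omega) (by omega)
    fun v _ _ => ?_
  obtain ⟨a, ha⟩ := exists_addr (n := n) (W := W) w
  obtain ⟨b, hb⟩ := exists_addr (n := n) (W := W) v
  omega

/-- Separation by depth: work below level `k` leaves lists, marks and back pointers at depth `k` and
beyond intact. This is what lets the trie serve as the recursion stack. -/
theorem Frame.node {w : List Bool} {c : ℕ} (h : Frame n W i k f g) (hi : i ≤ n) (hw : w ∈ W)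
    (hk : k ≤ w.length) (hc : c < 8) : g (addr n W w + c) = f (addr n W w + c) := by
  have := le_addr (n := n) (W := W) w
  refine h _ (by omega) (by omega) (by omega) (by omega) (by omega) (by omega) (by omega)
    fun v _ hv => ?_
  have hne : w ≠ v := by rintro rfl; omega
  exact ⟨addr_add_ne hw hne hc (by omega), addr_add_ne hw hne hc (by omega),
    addr_add_ne hw hne hc (by omega)⟩

theorem Frame.static (h : Frame n W i k f g) (hi : i ≤ n) (hf : Static n W f) :
    Static n W g where
  zero := (h.reg (by omega)).trans hf.zero
  one := (h.reg (by omega)).trans hf.one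
  first := (h.reg (by omega)).trans hf.first
  last := (h.reg (by omega)).trans hf.last
  root := (h.field (c := 0) hi (by omega)).trans hf.root
  parent b w hw := (h.field (c := 0) hi (by omega)).trans (hf.parent b w hw)
  letter b w hw := (h.field hi (by omega)).trans (hf.letter b w hw)
  var b w hw := (h.field hi (by omega)).trans (hf.var b w hw)

theorem Frame.chain {S : List (List Bool)} (h : Frame n W i k f g) (hi : i ≤ n)
    (hS : ∀ w ∈ S, w ∈ W ∧ k ≤ w.length) (hf : IsChain n W f S) : IsChain n W g S :=
  hf.congr fun w hw => h.node hi (hS w hw).1 (hS w hw).2 (by omega)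

end Memory

/-! ## The set of parents of a list of nodes -/

section Dedup

variable {n : ℕ} {W : List (List Bool)} {j : ℕ} {f₀ f : ℕ → ℕ} {inp : List ℕ} {out : List (List ℕ)}

/-- The nodes of `acc`, of depth `j`, are distinct, linked, and those of depth at most `j` that
are marked. -/
structure Dedup (n : ℕ) (W : List (List Bool)) (j : ℕ) (f₀ f : ℕ → ℕ)
    (acc : List (List Bool)) : Prop where
  frame : Frame n W 0 (j + 1) f₀ f
  head : f 13 = f₀ 13
  new : f 14 = headAddr n W acc
  chain : IsChain n W f acc
  mem : ∀ v ∈ acc, v ∈ W ∧ v.length = j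
  nodup : acc.Nodup
  mark : ∀ v ∈ W, v.length < j + 1 → f (addr n W v + 3) = if v ∈ acc then 1 else 0

/-- The mark of the parent decides membership in `acc` in constant time. -/
theorem dedup_body (hW : IsTrie W) (hst : Static n W f₀) {b : Bool} {w : List Bool}
    {acc : List (List Bool)} (hw : b :: w ∈ W) (hj : w.length = j) (hD : Dedup n W j f₀ f acc)
    (h9 : f 9 = addr n W (b :: w)) :
    Within prog 6 ⟨47, f, inp, out⟩ fun s => ∃ g acc', s = ⟨53, g, inp, out⟩ ∧
      Dedup n W j f₀ g acc' ∧ g 9 = addr n W (b :: w) ∧ ∀ v, v ∈ acc' ↔ v ∈ acc ∨ w = v := by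
  have hf := hD.frame.static (Nat.zero_le _) hst
  have hwW := hW.parent _ _ hw
  obtain ⟨a, ha⟩ := exists_addr (n := n) (W := W) w
  have hm := hD.mark w hwW (by omega)
  have e1 : Function.update f 12 (addr n W w) (addr n W w + 3) = if w ∈ acc then 1 else 0 := by
    rw [Function.update_of_ne (by omega), hm]
  refine Within.load (v := addr n W w) rfl h9 (hf.parent _ _ hw) ?_
  refine Within.load (a := addr n W w) rfl (by simp) e1 ?_
  set f2 := Function.update (Function.update f 12 (addr n W w)) 2 (if w ∈ acc then 1 else 0) with hf2
  have hn2 : ∀ u c, f2 (addr n W u + c) = f (addr n W u + c) := by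
    intro u c
    have := le_addr (n := n) (W := W) u
    rw [hf2, Function.update_of_ne (by omega), Function.update_of_ne (by omega)]
  have hD2 : Dedup n W j f₀ f2 acc :=
    { frame := (hD.frame.update _ (by omega)).update _ (by omega)
      head := by simpa [hf2] using hD.head
      new := by simpa [hf2] using hD.new
      chain := hD.chain.congr fun u _ => hn2 u 2
      mem := hD.mem
      nodup := hD.nodup
      mark := fun v hv hl => (hn2 v 3).trans (hD.mark v hv hl) }
  have h29 : f2 9 = addr n W (b :: w) := by simpa [hf2] using h9
  have h21 : f2 1 = 1 := by simpa [hf2] using hf.one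
  have h22 : f2 2 = if w ∈ acc then 1 else 0 := by simp [hf2]
  have h212 : f2 12 = addr n W w := by simp [hf2]
  -- From here on only the recorded facts about `f2` are used, not its nested updates.
  clear_value f2
  by_cases hacc : w ∈ acc
  · refine Within.jump rfl (by simp [h21, h22, hacc]) (Within.done ⟨f2, acc, rfl, hD2, h29, ?_⟩)
    intro v
    constructor
    · exact Or.inl
    · rintro (h | rfl)
      exacts [h, hacc]
  · refine Within.noJump rfl (by simp [h21, h22, hacc]) ?_
    refine Within.store rfl h212 h21 ?_
    refine Within.store (a := addr n W w) (v := headAddr n W acc) rfl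
      (by rw [Function.update_of_ne (by omega), h212])
      (by rw [Function.update_of_ne (by omega), hD2.new]) ?_
    refine Within.copy (v := addr n W w) rfl
      (by rw [Function.update_of_ne (by omega), Function.update_of_ne (by omega), h212]) ?_
    refine Within.done ⟨_, w :: acc, rfl, ?_, ?_, ?_⟩
    · constructor
      · exact (((hD2.frame.update_node _ hwW (by omega) (by omega)).update_node _ hwW (by omega)
          (by omega)).update _ (by omega))
      · rw [Function.update_of_ne (by omega), Function.update_of_ne (by omega),
          Function.update_of_ne (by omega), hD2.head]
      · simp [headAddr]
      · refine ⟨?_, hD2.chain.congr fun v hv => ?_⟩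
        · rw [Function.update_of_ne (by omega), Function.update_self]
        · have hne : w ≠ v := by rintro rfl; exact hacc hv
          have := le_addr (n := n) (W := W) v
          rw [Function.update_of_ne (by omega),
            Function.update_of_ne (addr_add_ne hwW hne (by omega) (by omega)).symm,
            Function.update_of_ne (addr_add_ne hwW hne (by omega) (by omega)).symm]
      · intro v hv
        rcases List.mem_cons.1 hv with rfl | hv
        exacts [⟨hwW, hj⟩, hD2.mem v hv]
      · exact List.nodup_cons.2 ⟨hacc, hD2.nodup⟩
      · intro v hv hl
        have := le_addr (n := n) (W := W) v
        rw [Function.update_of_ne (by omega),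
            Function.update_of_ne (addr_add_ne_of_ne (by omega) (by omega) (by omega))]
        rcases eq_or_ne w v with rfl | hne
        · simp
        · rw [Function.update_of_ne (addr_add_ne hwW hne (by omega) (by omega)).symm,
            hD2.mark v hv hl]
          simp [hne.symm]
    · rw [Function.update_of_ne (by omega), Function.update_of_ne (by omega),
          Function.update_of_ne (by omega), h29]
    · intro v
      rw [List.mem_cons, eq_comm, or_comm]

/-- The scanned list has depth `j + 1` while all writes to nodes occur at depth `j`, so the links of
`S` as they were in `f₀` remain readable. -/
theorem dedup_loop (hW : IsTrie W) (hst : Static n W f₀) (S : List (List Bool)) :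
    ∀ (f : ℕ → ℕ) (acc : List (List Bool)), S ≠ [] → (∀ w ∈ S, w ∈ W ∧ w.length = j + 1) →
      IsChain n W f₀ S → Dedup n W j f₀ f acc → f 9 = headAddr n W S →
      Within prog (8 * S.length) ⟨47, f, inp, out⟩ fun s => ∃ g acc', s = ⟨55, g, inp, out⟩ ∧
        Dedup n W j f₀ g acc' ∧ ∀ v, v ∈ acc' ↔ v ∈ acc ∨ ∃ w ∈ S, w.tail = v := by
  induction S with
  | nil => intro f acc h; exact absurd rfl h
  | cons u S ih =>
    intro f acc _ hS hch hD h9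
    obtain ⟨hu, hlu⟩ := hS u (by simp)
    obtain ⟨b, w, rfl⟩ : ∃ b w, u = b :: w := by
      cases u
      · simp at hlu
      · exact ⟨_, _, rfl⟩
    have hlw : w.length = j := by simpa using hlu
    refine ((dedup_body hW hst hu hlw hD h9).bind (l := 2 + 8 * S.length) ?_).le
      (by simp only [List.length_cons]; omega)
    rintro s ⟨g, acc', rfl, hD', h9', hacc⟩
    rw [add_comm]
    have hn : g (addr n W (b :: w) + 2) = headAddr n W S := by
      rw [hD'.frame.node (Nat.zero_le _) hu (by omega) (by omega)]
      exact hch.1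
    refine Within.load rfl h9' hn ?_
    have hD'' : Dedup n W j f₀ (Function.update g 9 (headAddr n W S)) acc' := by
      have hx : ∀ v c, Function.update g 9 (headAddr n W S) (addr n W v + c)
          = g (addr n W v + c) := fun v c => by
        have := le_addr (n := n) (W := W) v
        rw [Function.update_of_ne (by omega)]
      exact
        { frame := hD'.frame.update _ (by omega)
          head := by simpa using hD'.head
          new := by simpa using hD'.new
          chain := hD'.chain.congr fun v _ => hx v 2
          mem := hD'.mem
          nodup := hD'.nodup
          mark := fun v hv hl => (hx v 3).trans (hD'.mark v hv hl) }
    have h1 : g 1 = 1 := (hD'.frame.reg (by omega)).trans hst.one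
    rcases eq_or_ne S [] with rfl | hne
    · refine Within.noJump rfl (by simp [h1, headAddr]) (Within.done ⟨_, acc', rfl, hD'', ?_⟩)
      intro v
      simp [hacc]
    · have := headAddr_pos (n := n) (W := W) hne
      refine Within.jump rfl (by simp [h1]; omega) ?_
      obtain ⟨t, ht, g', acc'', hs, hD3, hacc'⟩ := ih _ acc' hne
        (fun v hv => hS v (by simp [hv])) hch.2 hD'' (by simp)
      refine ⟨t, ht, g', acc'', hs, hD3, fun v => ?_⟩
      rw [hacc', hacc, or_assoc]
      simp

/-- A trie node may later occur in other lists, so marks must be cleared; following the new list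
does this in time linear in its length. -/
theorem unmark_loop (S : List (List Bool)) :
    ∀ f : ℕ → ℕ, S ≠ [] → IsChain n W f S → f 9 = headAddr n W S → f 0 = 0 → f 1 = 1 →
      Within prog (3 * S.length) ⟨56, f, inp, out⟩ fun s => ∃ g, s = ⟨59, g, inp, out⟩ ∧
        (∀ v ∈ S, g (addr n W v + 3) = 0) ∧
        ∀ a, a ≠ 9 → (∀ v ∈ S, a ≠ addr n W v + 3) → g a = f a := by
  induction S with
  | nil => intro f h; exact absurd rfl h
  | cons u S ih =>
    intro f _ hch h9 h0 h1
    have hu := le_addr (n := n) (W := W) u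
    have hn : ∀ v, addr n W v + 2 ≠ addr n W u + 3 := fun v =>
      addr_add_ne_of_ne (by omega) (by omega) (by omega)
    rw [List.length_cons, show 3 * (S.length + 1) = 3 * S.length + 3 by ring]
    refine Within.store rfl h9 h0 ?_
    refine Within.load (a := addr n W u) (v := headAddr n W S) rfl
      (by rw [Function.update_of_ne (by simp only [headAddr]; omega)]; exact h9)
      (by rw [headAddr, Function.update_of_ne (hn u)]; exact hch.1) ?_
    rw [show headAddr n W (u :: S) = addr n W u from rfl]
    set f2 := Function.update (Function.update f (addr n W u + 3) 0) 9 (headAddr n W S) with hf2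
    have hf2' : ∀ a, a ≠ 9 → a ≠ addr n W u + 3 → f2 a = f a := by
      intro a h h'
      rw [hf2, Function.update_of_ne h, Function.update_of_ne h']
    have h21 : f2 1 = 1 := by rw [hf2' _ (by omega) (by omega), h1]
    have h29 : f2 9 = headAddr n W S := by simp [hf2]
    have h2u : f2 (addr n W u + 3) = 0 := by
      rw [hf2, Function.update_of_ne (by omega), Function.update_self]
    clear_value f2
    rcases eq_or_ne S [] with rfl | hne
    · refine Within.noJump rfl (by simp [h21, h29, headAddr]) (Within.done ⟨f2, rfl, ?_, ?_⟩)
      · simpa using h2u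
      · intro a h h'
        exact hf2' a h (h' u (by simp))
    · have := headAddr_pos (n := n) (W := W) hne
      refine Within.jump rfl (by rw [h21, h29]; omega) ?_
      obtain ⟨t, ht, g, hs, hm, hg⟩ := ih f2 hne
        (hch.2.congr fun v _ => hf2' _ (by have := le_addr (n := n) (W := W) v; omega) (hn v))
        h29 (by rw [hf2' _ (by omega) (by omega), h0]) h21
      refine ⟨t, ht, g, hs, ?_, ?_⟩
      · intro v hv
        rcases List.mem_cons.1 hv with rfl | hv
        -- Neither distinctness of `S` nor injectivity of `addr` on it is assumed: the field of the
        -- head may be rewritten later, but then also to 0.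
        · by_cases hvS : v ∈ S
          · exact hm v hvS
          · by_cases hx : ∃ v' ∈ S, addr n W v + 3 = addr n W v' + 3
            · obtain ⟨v', hv', he⟩ := hx
              rw [he]
              exact hm v' hv'
            · push Not at hx
              rw [hg _ (by omega) hx, h2u]
        · exact hm v hv
      · intro a h h'
        rw [hg a h fun v hv => h' v (by simp [hv]), hf2' a h (h' u (by simp))]

end Dedup

/-! ## The parents of the nodes with letter `1` -/

section Filter

variable {n : ℕ} {W : List (List Bool)} {j : ℕ} {f₀ f : ℕ → ℕ} {inp : List ℕ} {out : List (List ℕ)}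

/-- The nodes of `acc`, of depth `j`, are distinct and linked; marks are unchanged. -/
structure Filtered (n : ℕ) (W : List (List Bool)) (j : ℕ) (f₀ f : ℕ → ℕ)
    (acc : List (List Bool)) : Prop where
  frame : Frame n W 0 (j + 1) f₀ f
  head : f 13 = f₀ 13
  new : f 14 = headAddr n W acc
  chain : IsChain n W f acc
  mem : ∀ v ∈ acc, v ∈ W ∧ v.length = j
  nodup : acc.Nodup
  mark : ∀ v ∈ W, f (addr n W v + 3) = f₀ (addr n W v + 3)

theorem Filtered.update {acc : List (List Bool)} (hD : Filtered n W j f₀ f acc) {a : ℕ} (x : ℕ)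
    (ha : a = 2 ∨ a = 9 ∨ a = 12) : Filtered n W j f₀ (Function.update f a x) acc := by
  have hx : ∀ v c, Function.update f a x (addr n W v + c)
      = f (addr n W v + c) := fun v c => by
    have := le_addr (n := n) (W := W) v
    rw [Function.update_of_ne (by omega)]
  exact
    { frame := hD.frame.update _ (by omega)
      head := by rw [Function.update_of_ne (by omega), hD.head]
      new := by rw [Function.update_of_ne (by omega), hD.new]
      chain := hD.chain.congr fun v _ => hx v 2
      mem := hD.mem
      nodup := hD.nodup
      mark := fun v hv => (hx v 3).trans (hD.mark v hv) }

/-- No marks are needed here: distinct nodes with the same letter have distinct parents. This is the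
role of `hacc`. -/
theorem filter_body (hW : IsTrie W) (hst : Static n W f₀) {b : Bool} {w : List Bool}
    {acc : List (List Bool)} (hw : b :: w ∈ W) (hj : w.length = j) (hD : Filtered n W j f₀ f acc)
    (hacc : b = false → w ∉ acc) (h9 : f 9 = addr n W (b :: w)) :
    Within prog 6 ⟨69, f, inp, out⟩ fun s => ∃ g acc', s = ⟨75, g, inp, out⟩ ∧
      Filtered n W j f₀ g acc' ∧ g 9 = addr n W (b :: w) ∧
      ∀ v, v ∈ acc' ↔ v ∈ acc ∨ b :: w = false :: v := by
  have hf := hD.frame.static (Nat.zero_le _) hst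
  have hwW := hW.parent _ _ hw
  obtain ⟨a, ha⟩ := exists_addr (n := n) (W := W) w
  refine Within.load rfl h9 (hf.letter _ _ hw) ?_
  have hD2 := hD.update (a := 2) (letter b) (by omega)
  set f2 := Function.update f 2 (letter b) with hf2
  have h29 : f2 9 = addr n W (b :: w) := by simpa [hf2] using h9
  have h21 : f2 1 = 1 := by simpa [hf2] using hf.one
  have h22 : f2 2 = letter b := by simp [hf2]
  clear_value f2
  cases b with
  | true =>
    refine Within.noJump rfl (by simp [h21, h22, letter]) ?_
    refine Within.jump rfl le_rfl (Within.done ⟨f2, acc, rfl, hD2, h29, by simp⟩)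
  | false =>
    have hacc := hacc rfl
    have hf2 := hD2.frame.static (Nat.zero_le _) hst
    refine Within.jump rfl (by simp [h21, h22, letter]) ?_
    refine Within.load rfl h29 (hf2.parent _ _ hw) ?_
    have hD3 := hD2.update (a := 12) (addr n W w) (by omega)
    set f3 := Function.update f2 12 (addr n W w) with hf3
    have h39 : f3 9 = addr n W (false :: w) := by simpa [hf3] using h29
    have h312 : f3 12 = addr n W w := by simp [hf3]
    clear_value f3
    refine Within.store rfl h312 hD3.new ?_
    refine Within.copy (v := addr n W w) rfl (by rw [Function.update_of_ne (by omega), h312]) ?_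
    refine Within.done ⟨_, w :: acc, rfl, ?_, ?_, ?_⟩
    · constructor
      · exact (hD3.frame.update_node _ hwW (by omega) (by omega)).update _ (by omega)
      · rw [Function.update_of_ne (by omega), Function.update_of_ne (by omega), hD3.head]
      · simp [headAddr]
      · refine ⟨?_, hD3.chain.congr fun v hv => ?_⟩
        · rw [Function.update_of_ne (by omega), Function.update_self]
        · have hne : w ≠ v := by rintro rfl; exact hacc hv
          have := le_addr (n := n) (W := W) v
          rw [Function.update_of_ne (by omega),
            Function.update_of_ne (addr_add_ne hwW hne (by omega) (by omega)).symm]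
      · intro v hv
        rcases List.mem_cons.1 hv with rfl | hv
        exacts [⟨hwW, hj⟩, hD3.mem v hv]
      · exact List.nodup_cons.2 ⟨hacc, hD3.nodup⟩
      · intro v hv
        have := le_addr (n := n) (W := W) v
        rw [Function.update_of_ne (by omega),
          Function.update_of_ne (addr_add_ne_of_ne (by omega) (by omega) (by omega)),
          hD3.mark v hv]
    · rw [Function.update_of_ne (by omega), Function.update_of_ne (by omega), h39]
    · intro v
      rw [List.mem_cons, or_comm, List.cons.injEq]
      simp [eq_comm]

/-- Disjointness of the collected parents from those still to come is carried by the hypothesis on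
`false :: v`, and preserved because `S` has no duplicates. -/
theorem filter_loop (hW : IsTrie W) (hst : Static n W f₀) (S : List (List Bool)) :
    ∀ (f : ℕ → ℕ) (acc : List (List Bool)), S ≠ [] → S.Nodup →
      (∀ w ∈ S, w ∈ W ∧ w.length = j + 1) → (∀ v ∈ acc, false :: v ∉ S) →
      IsChain n W f₀ S → Filtered n W j f₀ f acc → f 9 = headAddr n W S →
      Within prog (8 * S.length) ⟨69, f, inp, out⟩ fun s => ∃ g acc', s = ⟨77, g, inp, out⟩ ∧
        Filtered n W j f₀ g acc' ∧ ∀ v, v ∈ acc' ↔ v ∈ acc ∨ false :: v ∈ S := by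
  induction S with
  | nil => intro f acc h; exact absurd rfl h
  | cons u S ih =>
    intro f acc _ hnd hS hdisj hch hD h9
    obtain ⟨hu, hlu⟩ := hS u (by simp)
    obtain ⟨b, w, rfl⟩ : ∃ b w, u = b :: w := by
      cases u
      · simp at hlu
      · exact ⟨_, _, rfl⟩
    have hlw : w.length = j := by simpa using hlu
    have hwacc : b = false → w ∉ acc := by
      rintro rfl hw
      exact hdisj w hw (by simp)
    refine ((filter_body hW hst hu hlw hD hwacc h9).bind (l := 2 + 8 * S.length) ?_).le
      (by simp only [List.length_cons]; omega)
    rintro s ⟨g, acc', rfl, hD', h9', hacc⟩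
    rw [add_comm]
    have hn : g (addr n W (b :: w) + 2) = headAddr n W S := by
      rw [hD'.frame.node (Nat.zero_le _) hu (by omega) (by omega)]
      exact hch.1
    refine Within.load rfl h9' hn ?_
    have hD'' := hD'.update (a := 9) (headAddr n W S) (by omega)
    have h1 : g 1 = 1 := (hD'.frame.reg (by omega)).trans hst.one
    rcases eq_or_ne S [] with rfl | hne
    · refine Within.noJump rfl (by simp [h1, headAddr]) (Within.done ⟨_, acc', rfl, hD'', ?_⟩)
      intro v
      simp [hacc, eq_comm]
    · have := headAddr_pos (n := n) (W := W) hne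
      refine Within.jump rfl (by simp [h1]; omega) ?_
      have hnd' := List.nodup_cons.1 hnd
      obtain ⟨t, ht, g', acc'', hs, hD3, hacc'⟩ := ih _ acc' hne hnd'.2
        (fun v hv => hS v (by simp [hv]))
        (fun v hv hvS => by
          rcases (hacc v).1 hv with hv | hv
          · exact hdisj v hv (by simp [hvS])
          · exact hnd'.1 (hv ▸ hvS))
        hch.2 hD'' (by simp)
      refine ⟨t, ht, g', acc'', hs, hD3, fun v => ?_⟩
      rw [hacc', hacc, or_assoc, List.mem_cons, eq_comm (a := b :: w)]

end Filter

/-! ## The enumeration -/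

section Enumerate

variable {n : ℕ} {W : List (List Bool)} {j k : ℕ} {f f₀ : ℕ → ℕ} {inp : List ℕ}
  {out : List (List ℕ)} {S S' : List (List Bool)}

/-- `S` is a nonempty list of distinct nodes of depth `j`, linked in memory. -/
structure Level (n : ℕ) (W : List (List Bool)) (j : ℕ) (f : ℕ → ℕ) (S : List (List Bool)) :
    Prop where
  ne : S ≠ []
  nodup : S.Nodup
  mem : ∀ w ∈ S, w ∈ W ∧ w.length = j
  chain : IsChain n W f S

/-- The nodes of depth less than `k` are not marked. -/
def Unmarked (n : ℕ) (W : List (List Bool)) (k : ℕ) (f : ℕ → ℕ) : Prop :=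
  ∀ v ∈ W, v.length < k → f (addr n W v + 3) = 0

theorem Level.frame {g : ℕ → ℕ} {i : ℕ} (h : Level n W j f S) (hF : Frame n W i k f g) (hi : i ≤ n)
    (hk : k ≤ j) : Level n W j g S :=
  ⟨h.ne, h.nodup, h.mem,
    hF.chain hi (fun w hw => ⟨(h.mem w hw).1, by rw [(h.mem w hw).2]; exact hk⟩) h.chain⟩

theorem Level.head_eq (h : Level n W j f S) :
    ∃ w ∈ S, w ∈ W ∧ w.length = j ∧ headAddr n W S = addr n W w := by
  rcases S with _ | ⟨w, S⟩
  · exact absurd rfl h.ne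
  · exact ⟨w, by simp, (h.mem w (by simp)).1, (h.mem w (by simp)).2, rfl⟩

theorem Level.var (h : Level n W (j + 1) f₀ S) (hst : Static n W f) :
    f (headAddr n W S + 4) = 16 + j := by
  obtain ⟨w, -, hw, hl, e⟩ := h.head_eq
  rw [e]
  cases w with
  | nil => simp at hl
  | cons b w => rw [hst.var b w hw, ← Nat.succ_injective hl]

theorem Level.parent_ne (h : Level n W (j + 1) f₀ S) (hst : Static n W f) :
    16 ≤ f (headAddr n W S) := by
  obtain ⟨w, -, hw, hl, e⟩ := h.head_eq
  rw [e]
  cases w with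
  | nil => simp at hl
  | cons b w => rw [hst.parent b w hw]; exact (Nat.le_add_right _ _).trans (le_addr w)

theorem Level.frame_head {g : ℕ → ℕ} {i c : ℕ} (h : Level n W j f₀ S) (hF : Frame n W i k f g)
    (hi : i ≤ n) (hk : k ≤ j) (hc : c < 8) : g (headAddr n W S + c) = f (headAddr n W S + c) := by
  obtain ⟨w, -, hw, hl, e⟩ := h.head_eq
  rw [e]
  exact hF.node hi hw (by omega) hc

/-- Line `78` to line `41`: the new list becomes the current one. -/
theorem push_level (hS' : Level n W j f S') (h14 : f 14 = headAddr n W S')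
    (hm : Unmarked n W k f) :
    Within prog 3 ⟨78, f, inp, out⟩ fun s => ∃ g, s = ⟨41, g, inp, out⟩ ∧
      Frame n W 0 (j + 1) f g ∧ Level n W j g S' ∧ g 13 = headAddr n W S' ∧
      g (headAddr n W S' + 5) = f 13 ∧ Unmarked n W k g := by
  have hpos := headAddr_pos (n := n) (W := W) hS'.ne
  obtain ⟨w, hw, hwW, hl, e⟩ := hS'.head_eq
  rw [e] at hpos h14 ⊢
  refine Within.store rfl h14 rfl ?_
  refine Within.copy (v := addr n W w) rfl (by rw [Function.update_of_ne (by omega), h14]) ?_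
  refine Within.jump rfl le_rfl ?_
  have hF : Frame n W 0 (j + 1) f (Function.update (Function.update f (addr n W w + 5) (f 13)) 13
      (addr n W w)) :=
    (Frame.refl.update_node _ hwW (by omega) (by omega)).update _ (by omega)
  have hx : ∀ v c, c ≠ 5 → c < 8 → Function.update (Function.update f (addr n W w + 5) (f 13)) 13
      (addr n W w) (addr n W v + c) = f (addr n W v + c) := fun v c hc hc' => by
    have := le_addr (n := n) (W := W) v
    rw [Function.update_of_ne (by omega),
      Function.update_of_ne (addr_add_ne_of_ne hc hc' (by omega))]
  refine Within.done ⟨_, rfl, hF, ⟨hS'.ne, hS'.nodup, hS'.mem, hS'.chain.congr fun v _ =>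
    hx v 2 (by omega) (by omega)⟩, by simp, ?_,
    fun v hv hl => (hx v 3 (by omega) (by omega)).trans (hm v hv hl)⟩
  rw [Function.update_of_ne (by omega), Function.update_self]

/-- The branch where the variable is 1. By monotonicity no term is lost, so the new list is
nonempty. -/
theorem descend_true (hW : IsTrie W) (hst : Static n W f) (hS : Level n W (j + 1) f S)
    (hj : j < n) (h13 : f 13 = headAddr n W S) (hm : Unmarked n W (j + 1) f) :
    Within prog (22 * S.length) ⟨41, f, inp, out⟩ fun s => ∃ g S', s = ⟨41, g, inp, out⟩ ∧
      Frame n W (j + 1) (j + 1) f g ∧ Level n W j g S' ∧ g 13 = headAddr n W S' ∧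
      g (headAddr n W S' + 5) = headAddr n W S ∧ Unmarked n W (j + 1) g ∧ g (16 + j) = 1 ∧
      ∀ v, v ∈ S' ↔ ∃ w ∈ S, w.tail = v := by
  have hpos := headAddr_pos (n := n) (W := W) hS.ne
  have hlen : 1 ≤ S.length := List.length_pos_iff.2 hS.ne
  have hpar := hS.parent_ne hst
  -- Setup, deduplication, then unmarking and pushing: `11 * |S| + 11` steps, at most `22 * |S|`
  -- since `S` is nonempty.
  refine Within.le (k := 8 * S.length + (3 * S.length + 5) + 6) ?_ (by omega)
  refine Within.load (v := f (headAddr n W S)) rfl h13 rfl ?_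
  refine Within.noJump rfl (by simp [hst.zero]; omega) ?_
  refine Within.load (a := headAddr n W S) (v := 16 + j) rfl
    (by rw [Function.update_of_ne (by omega), h13])
    (by rw [Function.update_of_ne (by omega), hS.var hst]) ?_
  refine Within.store (a := 16 + j) (v := 1) rfl (by simp) (by simp [hst.one]) ?_
  refine Within.copy (v := 0) rfl
    (by rw [Function.update_of_ne (by omega)]; simp [hst.zero]) ?_
  refine Within.copy (v := headAddr n W S) rfl
    (by rw [Function.update_of_ne (by omega), Function.update_of_ne (by omega)]; simp [h13]) ?_
  simp only [add_zero]
  set f1 := Function.update (Function.update (Function.update (Function.update (Function.update f 12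
    (f (headAddr n W S))) 11 (16 + j)) (16 + j) 1) 14 0) 9 (headAddr n W S) with hf1
  have hF1 : Frame n W (j + 1) (j + 1) f f1 :=
    ((((Frame.refl.update _ (by omega)).update _ (by omega)).update_var _ (by omega)
      (by omega)).update _ (by omega)).update _ (by omega)
  have hx1 : f1 (16 + j) = 1 := by
    rw [hf1, Function.update_of_ne (by omega), Function.update_of_ne (by omega),
      Function.update_self]
  have h113 : f1 13 = headAddr n W S := by
    rw [hf1, Function.update_of_ne (by omega), Function.update_of_ne (by omega),
      Function.update_of_ne (by omega)]
    simp [h13]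
  have h114 : f1 14 = 0 := by simp [hf1]
  have h19 : f1 9 = headAddr n W S := by simp [hf1]
  have hm1 : Unmarked n W (j + 1) f1 := by
    intro v hv hl
    have := le_addr (n := n) (W := W) v
    rw [hf1, Function.update_of_ne (by omega), Function.update_of_ne (by omega),
      Function.update_of_ne (by omega), Function.update_of_ne (by omega),
      Function.update_of_ne (by omega), hm v hv hl]
  clear_value f1
  have hst1 := hF1.static (by omega) hst
  have hS1 := hS.frame hF1 (by omega) le_rfl
  have hD : Dedup n W j f1 f1 [] :=
    ⟨Frame.refl, rfl, h114, trivial, by simp, by simp, fun v hv hl => by simpa using hm1 v hv hl⟩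
  refine (dedup_loop hW hst1 S f1 [] hS.ne hS.mem hS1.chain hD h19).bind ?_
  rintro s ⟨f2, S', rfl, hD2, hmem⟩
  have hmem : ∀ v, v ∈ S' ↔ ∃ w ∈ S, w.tail = v := by simpa using hmem
  have hne : S' ≠ [] := by
    obtain ⟨w, hw⟩ := List.exists_mem_of_ne_nil _ hS.ne
    exact List.ne_nil_of_mem ((hmem w.tail).2 ⟨w, hw, rfl⟩)
  -- Unmarking runs over the new list; it is duplicate-free and consists of parents of nodes of `S`,
  -- hence is no longer than `S`.
  have hlen' : S'.length ≤ S.length := by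
    classical
    have : S' ⊆ S.map List.tail := fun v hv => by simpa using (hmem v).1 hv
    simpa using (hD2.nodup.subperm this).length_le
  have hst2 := hD2.frame.static (by omega) hst1
  have hpos' := headAddr_pos (n := n) (W := W) hne
  refine Within.le (k := 3 * S'.length + 4 + 1) ?_ (by omega)
  refine Within.copy rfl hD2.new ?_
  refine (unmark_loop S' (Function.update f2 9 (headAddr n W S')) hne
    (hD2.chain.congr fun v _ => ?_) (by simp) (by simp [hst2.zero]) (by simp [hst2.one])).bind ?_
  · have := le_addr (n := n) (W := W) v
    rw [Function.update_of_ne (by omega)]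
  rintro s ⟨f3, rfl, hz, hf3⟩
  have hf3' : ∀ a, a ≠ 9 → (∀ v ∈ S', a ≠ addr n W v + 3) → f3 a = f2 a := by
    intro a ha h
    rw [hf3 a ha h, Function.update_of_ne ha]
  have hF3 : Frame n W 0 (j + 1) f2 f3 := fun a _ h9 _ _ _ _ _ h =>
    hf3' a h9 fun v hv => (h v (hD2.mem v hv).1 (by have := (hD2.mem v hv).2; omega)).2.1
  have hlow : ∀ a < 16, a ≠ 9 → f3 a = f2 a := fun a ha ha' => hf3' a ha' fun v _ => by
    have := le_addr (n := n) (W := W) v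
    omega
  have hS' : Level n W j f3 S' := by
    refine ⟨hne, hD2.nodup, hD2.mem, hD2.chain.congr fun v _ => hf3' _ ?_ fun v' _ => ?_⟩
    · have := le_addr (n := n) (W := W) v
      omega
    · exact addr_add_ne_of_ne (by omega) (by omega) (by omega)
  have hm3 : Unmarked n W (j + 1) f3 := by
    intro v hv hl
    by_cases hvS : v ∈ S'
    · exact hz v hvS
    · rw [hf3', hD2.mark v hv hl, if_neg hvS]
      · have := le_addr (n := n) (W := W) v
        omega
      · intro v' hv'
        have hne : v ≠ v' := by rintro rfl; exact hvS hv'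
        exact addr_add_ne hv hne (by omega) (by omega)
  refine Within.jump rfl le_rfl ?_
  obtain ⟨t, ht, g, hs, hF4, hL, h1, h2, h3⟩ := push_level (inp := inp) (out := out) hS'
    (by rw [hlow 14 (by omega) (by omega), hD2.new]) hm3
  have hF : Frame n W 0 (j + 1) f1 g := (hD2.frame.trans hF3).trans hF4
  refine ⟨t, ht, g, S', hs, hF1.trans (hF.mono (by omega) le_rfl), hL, h1, ?_, h3, ?_, hmem⟩
  · rw [h2, hlow 13 (by omega) (by omega), hD2.head, h113]
  · rw [hF.var (by omega) hj, hx1]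

/-- Starts when the branch 1 has just ended, with register 13 at the head of the child list. If no
term survives, the machine is already in the state that signals the end of `S`. -/
theorem descend_false (hW : IsTrie W) (hst : Static n W f) (hS : Level n W (j + 1) f S)
    (hj : j < n) (hback : f (f 13 + 5) = headAddr n W S) (hm : Unmarked n W (j + 1) f)
    (hx : f (16 + j) = 1) :
    Within prog (20 * S.length) ⟨61, f, inp, out⟩ fun s => ∃ g S',
      (S' = [] ∧ s = ⟨61, g, inp, out⟩ ∧ g 13 = headAddr n W S ∨
        s = ⟨41, g, inp, out⟩ ∧ Level n W j g S' ∧ g 13 = headAddr n W S' ∧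
          g (headAddr n W S' + 5) = headAddr n W S) ∧
      Frame n W (j + 1) (j + 1) f g ∧ Unmarked n W (j + 1) g ∧ g (16 + j) = 0 ∧
      ∀ v, v ∈ S' ↔ false :: v ∈ S := by
  have hpos := headAddr_pos (n := n) (W := W) hS.ne
  have hlen : 1 ≤ S.length := List.length_pos_iff.2 hS.ne
  refine Within.le (k := 8 * S.length + 4 + 8) ?_ (by omega)
  refine Within.load rfl rfl hback ?_
  refine Within.noJump rfl (by simp [hst.zero]; omega) ?_
  refine Within.load (a := headAddr n W S) (v := 16 + j) rfl (by simp)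
    (by rw [Function.update_of_ne (by omega), hS.var hst]) ?_
  refine Within.load (a := 16 + j) (v := 1) rfl (by simp)
    (by rw [add_zero, Function.update_of_ne (by omega), Function.update_of_ne (by omega), hx]) ?_
  refine Within.noJump rfl (by simp [hst.zero]) ?_
  refine Within.store (a := 16 + j) (v := 0) rfl (by simp) (by simp [hst.zero]) ?_
  refine Within.copy (v := 0) rfl
    (by rw [Function.update_of_ne (by omega)]; simp [hst.zero]) ?_
  refine Within.copy (v := headAddr n W S) rfl
    (by rw [Function.update_of_ne (by omega), Function.update_of_ne (by omega)]; simp) ?_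
  simp only [add_zero]
  set f1 := Function.update (Function.update (Function.update (Function.update (Function.update
    (Function.update f 13 (headAddr n W S)) 11 (16 + j)) 12 1) (16 + j) 0) 14 0) 9
    (headAddr n W S) with hf1
  have hF1 : Frame n W (j + 1) (j + 1) f f1 :=
    (((((Frame.refl.update _ (by omega)).update _ (by omega)).update _ (by omega)).update_var _
      (by omega) (by omega)).update _ (by omega)).update _ (by omega)
  have hx1 : f1 (16 + j) = 0 := by
    rw [hf1, Function.update_of_ne (by omega), Function.update_of_ne (by omega),
      Function.update_self]
  have h113 : f1 13 = headAddr n W S := by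
    rw [hf1, Function.update_of_ne (by omega), Function.update_of_ne (by omega),
      Function.update_of_ne (by omega)]
    simp
  have h114 : f1 14 = 0 := by simp [hf1]
  have h19 : f1 9 = headAddr n W S := by simp [hf1]
  have hm1 : Unmarked n W (j + 1) f1 := by
    intro v hv hl
    have := le_addr (n := n) (W := W) v
    rw [hf1, Function.update_of_ne (by omega), Function.update_of_ne (by omega),
      Function.update_of_ne (by omega), Function.update_of_ne (by omega),
      Function.update_of_ne (by omega), Function.update_of_ne (by omega), hm v hv hl]
  clear_value f1
  have hst1 := hF1.static (by omega) hst
  have hS1 := hS.frame hF1 (by omega) le_rfl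
  have hD : Filtered n W j f1 f1 [] :=
    ⟨Frame.refl, rfl, h114, trivial, by simp, by simp, fun v hv => rfl⟩
  refine (filter_loop hW hst1 S f1 [] hS.ne hS.nodup hS.mem (by simp) hS1.chain hD h19).bind ?_
  rintro s ⟨f2, S', rfl, hD2, hmem⟩
  have hmem : ∀ v, v ∈ S' ↔ false :: v ∈ S := by simpa using hmem
  have hst2 := hD2.frame.static (by omega) hst1
  have hm2 : Unmarked n W (j + 1) f2 := fun v hv hl => (hD2.mark v hv).trans (hm1 v hv hl)
  have hF2 := hF1.trans (hD2.frame.mono (Nat.zero_le _) le_rfl)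
  have hx2 : f2 (16 + j) = 0 := (hD2.frame.var (by omega) hj).trans hx1
  rcases eq_or_ne S' [] with rfl | hne
  · refine Within.jump rfl (by simp [hD2.new, headAddr]) (Within.done ⟨f2, [], Or.inl ⟨rfl, rfl, ?_⟩,
      hF2, hm2, hx2, hmem⟩)
    rw [hD2.head, h113]
  · have hpos' := headAddr_pos (n := n) (W := W) hne
    refine Within.noJump rfl (by rw [hD2.new, hst2.zero]; omega) ?_
    obtain ⟨t, ht, g, hs, hF3, hL, h1, h2, h3⟩ := push_level (inp := inp) (out := out)
      (⟨hne, hD2.nodup, hD2.mem, hD2.chain⟩ : Level n W j f2 S') hD2.new hm2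
    refine ⟨t, ht, g, S', Or.inr ⟨hs, hL, h1, ?_⟩, hF2.trans (hF3.mono (Nat.zero_le _) le_rfl), h3,
      (hF3.var (by omega) hj).trans hx2, hmem⟩
    rw [h2, hD2.head, h113]

/-- After the branch 0, the value 0 of the variable shows that `S` is finished too. -/
theorem ascend (hst : Static n W f) (hS : Level n W (j + 1) f S) (hj : j < n)
    (hback : f (f 13 + 5) = headAddr n W S) (hx : f (16 + j) = 0) (hm : Unmarked n W k f) :
    Within prog 5 ⟨61, f, inp, out⟩ fun s => ∃ g, s = ⟨61, g, inp, out⟩ ∧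
      g 13 = headAddr n W S ∧ Frame n W 0 0 f g ∧ Unmarked n W k g := by
  have hpos := headAddr_pos (n := n) (W := W) hS.ne
  refine Within.load rfl rfl hback ?_
  refine Within.noJump rfl (by simp [hst.zero]; omega) ?_
  refine Within.load (a := headAddr n W S) (v := 16 + j) rfl (by simp)
    (by rw [Function.update_of_ne (by omega), hS.var hst]) ?_
  refine Within.load (a := 16 + j) (v := 0) rfl (by simp)
    (by rw [add_zero, Function.update_of_ne (by omega), Function.update_of_ne (by omega), hx]) ?_
  refine Within.jump rfl (by simp) (Within.done ⟨_, rfl, by simp,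
    ((Frame.refl.update _ (by omega)).update _ (by omega)).update _ (by omega), ?_⟩)
  intro v hv hl
  have := le_addr (n := n) (W := W) v
  rw [Function.update_of_ne (by omega), Function.update_of_ne (by omega),
    Function.update_of_ne (by omega), hm v hv hl]

/-! ### Models of a set of words, and the amortized count -/

/-- The models, as reversed words, of the set of terms `S`. -/
def IsModelList (S O : List (List Bool)) : Prop :=
  O.Nodup ∧ ∀ α, α ∈ O ↔ ∃ w ∈ S, List.Forall₂ (· ≤ ·) w α

theorem forall₂_le_refl (w : List Bool) : List.Forall₂ (· ≤ ·) w w := by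
  induction w with
  | nil => exact .nil
  | cons b w ih => exact .cons le_rfl ih

/-- Every word is a model of itself, so distinct words give distinct models. This is the
amortization: scanning `S` costs a constant per model. -/
theorem IsModelList.length_le {O : List (List Bool)} (h : IsModelList S O) (hS : S.Nodup) :
    S.length ≤ O.length :=
  (hS.subperm fun w hw => (h.2 w).2 ⟨w, hw, forall₂_le_refl w⟩).length_le

/-- Splitting on the head variable. Any letter is at most `true`, so with value 1 every term
survives without its head; with value 0 only those with head `false` do. -/
theorem IsModelList.append {S₀ S₁ O₀ O₁ : List (List Bool)} (h₁ : IsModelList S₁ O₁)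
    (h₀ : IsModelList S₀ O₀) (hS : ∀ w ∈ S, w ≠ []) (hm₁ : ∀ v, v ∈ S₁ ↔ ∃ w ∈ S, w.tail = v)
    (hm₀ : ∀ v, v ∈ S₀ ↔ false :: v ∈ S) :
    IsModelList S (O₁.map (List.cons true) ++ O₀.map (List.cons false)) := by
  have inj : ∀ b : Bool, Function.Injective (List.cons b) := fun b _ _ h => (List.cons.inj h).2
  constructor
  · rw [List.nodup_append']
    refine ⟨h₁.1.map (inj _), h₀.1.map (inj _), ?_⟩
    intro α h h'
    obtain ⟨β, -, rfl⟩ := List.mem_map.1 h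
    obtain ⟨γ, -, h⟩ := List.mem_map.1 h'
    simp at h
  · intro α
    simp only [List.mem_append, List.mem_map, h₁.2, h₀.2, hm₁, hm₀]
    constructor
    · rintro (⟨β, ⟨v, ⟨w, hw, rfl⟩, h⟩, rfl⟩ | ⟨β, ⟨v, hv, h⟩, rfl⟩)
      · refine ⟨w, hw, ?_⟩
        cases w with
        | nil => exact absurd rfl (hS _ hw)
        | cons b w => exact .cons (Bool.le_true b) h
      · exact ⟨_, hv, .cons le_rfl h⟩
    · rintro ⟨w, hw, h⟩
      cases h with
      | nil => exact absurd rfl (hS _ hw)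
      | @cons b c w α hbc h =>
        cases c with
        | true => exact Or.inl ⟨α, ⟨w, ⟨_, hw, rfl⟩, h⟩, rfl⟩
        | false =>
          obtain rfl : b = false := le_bot_iff.1 hbc
          exact Or.inr ⟨α, ⟨w, hw, h⟩, rfl⟩

/-- The output word when the first variables are given by the reversed word `α`, and those from
number `j` on are read in the registers. -/
def outWord (n j : ℕ) (f : ℕ → ℕ) (α : List Bool) : List ℕ :=
  (α.map bit).reverse ++ (List.Ico (16 + j) (16 + n)).map f

theorem outWord_cons (hj : j < n) {b : Bool} (hb : f (16 + j) = bit b) {g : ℕ → ℕ}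
    (hg : ∀ i, j < i → i < n → f (16 + i) = g (16 + i)) (α : List Bool) :
    outWord n j f α = outWord n (j + 1) g (b :: α) := by
  have : (List.Ico (16 + (j + 1)) (16 + n)).map f = (List.Ico (16 + (j + 1)) (16 + n)).map g := by
    refine List.map_congr_left fun a ha => ?_
    obtain ⟨h1, h2⟩ := List.Ico.mem.1 ha
    have := hg (a - 16) (by omega) (by omega)
    rwa [show 16 + (a - 16) = a by omega] at this
  unfold outWord
  rw [List.Ico.eq_cons (by omega : 16 + j < 16 + n), List.map_cons, hb, List.map_cons,
    List.reverse_cons, List.append_assoc, show 16 + j + 1 = 16 + (j + 1) by ring, this]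
  rfl

/-- Induction on the depth. The work outside the two recursive calls is `O(|S|)`, hence `O(|O|)`,
and adds one unit to the factor `j + 1`. The frame in the conclusion is what allows the second call
to find the list `S` unchanged. -/
theorem enumerate (hW : IsTrie W) :
    ∀ (j : ℕ) (S : List (List Bool)) (f : ℕ → ℕ) (out : List (List ℕ)), j ≤ n → Static n W f →
      Level n W j f S → f 13 = headAddr n W S → Unmarked n W j f →
      ∃ O g, IsModelList S O ∧ Frame n W j j f g ∧ g 13 = headAddr n W S ∧ Unmarked n W j g ∧
        Within prog (50 * ((j + 1) * O.length)) ⟨41, f, inp, out⟩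
          (· = ⟨61, g, inp, out ++ O.map (outWord n j f)⟩) := by
  intro j
  induction j with
  | zero =>
    intro S f out _ hst hS h13 hm
    -- At depth 0 the only possible list without duplicates is the root alone: some term is
    -- satisfied and the full assignment is the only model left.
    have hnil : ∀ w ∈ S, w = [] := fun w hw => List.length_eq_zero_iff.1 (hS.mem w hw).2
    have hS1 : S = [[]] := by
      rcases S with _ | ⟨w, _ | ⟨v, S⟩⟩
      · exact absurd rfl hS.ne
      · rw [hnil w (by simp)]
      · have := hS.nodup
        rw [hnil w (by simp), hnil v (by simp)] at this
        simp at this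
    subst hS1
    refine ⟨[[]], Function.update f 12 0, ⟨by simp, fun α => by simp⟩, Frame.refl.update _ (by omega),
      by simpa using h13, fun _ _ h => absurd h (by omega), ?_⟩
    refine Within.le (k := 0 + 3) ?_ (by simp)
    refine Within.load (v := 0) rfl h13 hst.root ?_
    refine Within.jump rfl (by simp [hst.zero]) (Within.output rfl (Within.done ?_))
    have h1 : Function.update f 12 0 4 = 16 := by simp [hst.first]
    have h2 : Function.update f 12 0 5 + 1 = 16 + n := by
      rw [Function.update_of_ne (by omega), hst.last]; ring
    rw [h1, h2]
    have : (List.Ico 16 (16 + n)).map (Function.update f 12 0) = outWord n 0 f [] := by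
      unfold outWord
      refine List.map_congr_left fun a ha => ?_
      have := (List.Ico.mem.1 ha).1
      rw [Function.update_of_ne (by omega)]
    rw [this]
    rfl
  | succ j ih =>
    intro S f out hjn hst hS h13 hm
    obtain ⟨t₁, ht₁, f₁, S₁, hs₁, hF₁, hL₁, h13₁, hback₁, hm₁, hx₁, hmem₁⟩ :=
      descend_true (inp := inp) (out := out) hW hst hS (by omega) h13 hm
    have hst₁ := hF₁.static (by omega) hst
    obtain ⟨O₁, g₁, hO₁, hG₁, h13g₁, hmg, hw₁⟩ := ih S₁ f₁ out (by omega) hst₁ hL₁ h13₁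
      fun v hv hl => hm₁ v hv (by omega)
    have hst₂ := hG₁.static (by omega) hst₁
    -- The induction hypothesis covers depths below `j`; nodes of depth exactly `j` lie outside its
    -- frame and keep the marks they had before the call.
    have hmg₁ : Unmarked n W (j + 1) g₁ := by
      intro v hv hl
      rcases Nat.lt_succ_iff_lt_or_eq.1 hl with hl' | hl'
      · exact hmg v hv hl'
      · rw [hG₁.node (by omega) hv hl'.ge (by omega), hm₁ v hv hl]
    have hFg₁ : Frame n W (j + 1) (j + 1) f g₁ :=
      hF₁.trans (hG₁.mono (by omega) (by omega))
    have hout₁ : ∀ α, outWord n j f₁ α = outWord n (j + 1) f (true :: α) :=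
      outWord_cons (by omega) hx₁ fun i hi hi' => hF₁.var (by omega) hi'
    obtain ⟨t₂, ht₂, f₂, S₀, hs₂, hF₂, hm₂, hx₂, hmem₂⟩ :=
      descend_false (inp := inp) (out := out ++ O₁.map (outWord n j f₁)) hW hst₂
        (hS.frame hFg₁ (by omega) le_rfl) (by omega)
        -- The back pointer sits in a node of depth `j`, so the recursive call has not touched it.
        (by rw [h13g₁, hL₁.frame_head hG₁ (by omega) le_rfl (by omega), hback₁]) hmg₁
        (by rw [hG₁.var le_rfl (by omega), hx₁])
    have hFf₂ := hFg₁.trans hF₂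
    have hnil : ∀ w ∈ S, w ≠ [] := by
      rintro w hw rfl
      simpa using (hS.mem _ hw).2
    have hW₁ : Within prog (22 * S.length) ⟨41, f, inp, out⟩ (· = ⟨41, f₁, inp, out⟩) :=
      ⟨t₁, ht₁, hs₁⟩
    have hW₂ := hW₁.bind (l := 50 * ((j + 1) * O₁.length))
      (R := (· = ⟨61, g₁, inp, out ++ O₁.map (outWord n j f₁)⟩)) (by rintro s rfl; exact hw₁)
    have hpos : 1 ≤ S.length := List.length_pos_iff.2 hS.ne
    rcases hs₂ with ⟨rfl, hs₂, h13₂⟩ | ⟨hs₂, hL₂, h13₂, hback₂⟩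
    · have hO := hO₁.append (S := S) (S₀ := []) (O₀ := []) ⟨List.nodup_nil, by simp⟩ hnil hmem₁ hmem₂
      have hlen := hO.length_le hS.nodup
      refine ⟨_, f₂, hO, hFf₂, h13₂, hm₂, ?_⟩
      refine (hW₂.bind (l := 20 * S.length) ?_).le ?_
      · rintro s rfl
        refine ⟨t₂, ht₂, hs₂.trans ?_⟩
        simp [hout₁]
      · simp only [List.map_nil, List.append_nil, List.length_map] at hlen ⊢
        nlinarith
    · have hst₃ := hF₂.static (by omega) hst₂
      obtain ⟨O₀, g₂, hO₀, hG₂, h13g₂, hmg', hw₂⟩ :=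
        ih S₀ f₂ (out ++ O₁.map (outWord n j f₁)) (by omega) hst₃ hL₂ h13₂
          fun v hv hl => hm₂ v hv (by omega)
      have hst₄ := hG₂.static (by omega) hst₃
      have hmg₂ : Unmarked n W (j + 1) g₂ := by
        intro v hv hl
        rcases Nat.lt_succ_iff_lt_or_eq.1 hl with hl' | hl'
        · exact hmg' v hv hl'
        · rw [hG₂.node (by omega) hv hl'.ge (by omega), hm₂ v hv hl]
      have hFg₂ : Frame n W (j + 1) (j + 1) f g₂ :=
        hFf₂.trans (hG₂.mono (by omega) (by omega))
      have hout₀ : ∀ α, outWord n j f₂ α = outWord n (j + 1) f (false :: α) :=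
        outWord_cons (by omega) hx₂ fun i hi hi' => hFf₂.var (by omega) hi'
      obtain ⟨t₃, ht₃, g₃, hs₃, h13g₃, hF₃, hm₃⟩ := ascend (inp := inp)
        (out := out ++ O₁.map (outWord n j f₁) ++ O₀.map (outWord n j f₂)) hst₄
        (hS.frame hFg₂ (by omega) le_rfl) (by omega)
        (by rw [h13g₂, hL₂.frame_head hG₂ (by omega) le_rfl (by omega), hback₂])
        (by rw [hG₂.var le_rfl (by omega), hx₂]) hmg₂
      have hO := hO₁.append hO₀ hnil hmem₁ hmem₂
      have hlen := hO.length_le hS.nodup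
      refine ⟨_, g₃, hO, hFg₂.trans (hF₃.mono (Nat.zero_le _) (Nat.zero_le _)), h13g₃, hm₃, ?_⟩
      have hW₃ := hW₂.bind (l := 20 * S.length)
        (R := (· = ⟨41, f₂, inp, out ++ O₁.map (outWord n j f₁)⟩))
        (by rintro s rfl; exact ⟨t₂, ht₂, hs₂⟩)
      have hW₄ := hW₃.bind (l := 50 * ((j + 1) * O₀.length))
        (R := (· = ⟨61, g₂, inp, out ++ O₁.map (outWord n j f₁) ++ O₀.map (outWord n j f₂)⟩))
        (by rintro s rfl; exact hw₂)
      refine (hW₄.bind (l := 5) ?_).le ?_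
      · rintro s rfl
        refine ⟨t₃, ht₃, hs₃.trans ?_⟩
        simp [funext hout₁, funext hout₀, Function.comp_def]
      -- The local work is at most `22 * |S| + 20 * |S| + 5 ≤ 47 * |S|`, and `|S| ≤ |O₁| + |O₀|`;
      -- this is where 50 comes from.
      · simp only [List.length_append, List.length_map] at hlen ⊢
        nlinarith

end Enumerate

/-! ## Construction of the trie -/

section Construct

variable {n : ℕ} {W S : List (List Bool)} {f g : ℕ → ℕ} {inp : List ℕ}
  {out : List (List ℕ)} {b : Bool} {w : List Bool}

/-- The state of the memory while terms are read; `W` are the nodes of the trie, `S` the leaves. -/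
structure Build (n : ℕ) (W S : List (List Bool)) (f : ℕ → ℕ) : Prop where
  trie : IsTrie W
  static : Static n W f
  four : f 6 = 4
  rootReg : f 7 = 16 + n
  free : f 8 = 16 + n + 8 * W.length
  head : f 13 = headAddr n W S
  nil : addr n W [] = 16 + n
  child : ∀ w ∈ W, ∀ b : Bool,
    f (addr n W w + (6 + b.toNat)) = if b :: w ∈ W then addr n W (b :: w) else 0
  mark : ∀ w ∈ W, f (addr n W w + 3) = 0
  back : ∀ w ∈ W, f (addr n W w + 5) = 0
  fresh : ∀ a, 16 + n + 8 * W.length ≤ a → f a = 0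
  chain : IsChain n W f S
  nodup : S.Nodup
  mem : ∀ w ∈ S, w ∈ W ∧ w.length = n

/-- New nodes go to the end of `W`, so existing addresses never move. -/
theorem addr_append {u : List Bool} (v : List Bool) (hu : u ∈ W) :
    addr n (W ++ [v]) u = addr n W u := by
  rw [addr, addr, List.idxOf_append_of_mem hu]

theorem addr_append_self {v : List Bool} (hv : v ∉ W) :
    addr n (W ++ [v]) v = 16 + n + 8 * W.length := by
  rw [addr, List.idxOf_append_of_notMem hv]
  simp

theorem addr_lt {u : List Bool} (hu : u ∈ W) : addr n W u + 8 ≤ 16 + n + 8 * W.length := by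
  have := List.idxOf_lt_length_of_mem hu
  unfold addr
  omega

theorem headAddr_append (v : List Bool) (hS : ∀ w ∈ S, w ∈ W) :
    headAddr n (W ++ [v]) S = headAddr n W S := by
  cases S with
  | nil => rfl
  | cons u S => exact addr_append v (hS u (by simp))

theorem IsChain.append (v : List Bool) (hS : ∀ w ∈ S, w ∈ W) (h : IsChain n W f S) :
    IsChain n (W ++ [v]) f S := by
  induction S with
  | nil => trivial
  | cons u S ih =>
    refine ⟨?_, ih (fun w hw => hS w (by simp [hw])) h.2⟩
    rw [addr_append v (hS u (by simp)), headAddr_append v fun w hw => hS w (by simp [hw])]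
    exact h.1

theorem Build.congr (h : Build n W S f)
    (hg : ∀ a, a ≠ 2 → a ≠ 3 → a ≠ 9 → a ≠ 10 → a ≠ 11 → a ≠ 12 → g a = f a) :
    Build n W S g := by
  have hx : ∀ u c, g (addr n W u + c) = f (addr n W u + c) := fun u c => by
    have := le_addr (n := n) (W := W) u
    exact hg _ (by omega) (by omega) (by omega) (by omega) (by omega) (by omega)
  have hr : ∀ a, (a = 0 ∨ a = 1 ∨ a = 4 ∨ a = 5 ∨ a = 6 ∨ a = 7 ∨ a = 8 ∨ a = 13 ∨ 16 ≤ a) →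
      g a = f a := fun a ha =>
    hg _ (by omega) (by omega) (by omega) (by omega) (by omega) (by omega)
  exact
    { h with
      static :=
        { zero := (hr 0 (by omega)).trans h.static.zero
          one := (hr 1 (by omega)).trans h.static.one
          first := (hr 4 (by omega)).trans h.static.first
          last := (hr 5 (by omega)).trans h.static.last
          root := (hx [] 0).trans h.static.root
          parent := fun b w hw => (hx _ 0).trans (h.static.parent b w hw)
          letter := fun b w hw => (hx _ 1).trans (h.static.letter b w hw)
          var := fun b w hw => (hx _ 4).trans (h.static.var b w hw) }
      four := (hr 6 (by omega)).trans h.four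
      rootReg := (hr 7 (by omega)).trans h.rootReg
      free := (hr 8 (by omega)).trans h.free
      head := (hr 13 (by omega)).trans h.head
      child := fun w hw b => (hx w _).trans (h.child w hw b)
      mark := fun w hw => (hx w 3).trans (h.mark w hw)
      back := fun w hw => (hx w 5).trans (h.back w hw)
      fresh := fun a ha => (hr a (by omega)).trans (h.fresh a ha)
      chain := h.chain.congr fun w _ => hx w 2 }

theorem Build.update (h : Build n W S f) {a : ℕ} (v : ℕ)
    (ha : a = 2 ∨ a = 3 ∨ a = 9 ∨ a = 10 ∨ a = 11 ∨ a = 12) :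
    Build n W S (Function.update f a v) :=
  h.congr fun b _ _ _ _ _ _ => by rw [Function.update_of_ne (by omega)]

/-- The new node takes the first free block. Its registers are still 0, so children, mark and back
pointer need no initialization. -/
theorem Build.extend (h : Build n W S f) (hw : w ∈ W) (hbw : b :: w ∉ W) {p : ℕ}
    (hp : p = 16 + n + 8 * W.length)
    (hchild : g (addr n W w + (6 + b.toNat)) = p) (hparent : g p = addr n W w)
    (hletter : g (p + 1) = letter b) (hvar : g (p + 4) = 16 + w.length) (hfree : g 8 = p + 8)
    (hg : ∀ a, a ≠ 2 → a ≠ 8 → a ≠ 12 → a ≠ addr n W w + (6 + b.toNat) → a ≠ p → a ≠ p + 1 →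
      a ≠ p + 4 → g a = f a) :
    Build n (W ++ [b :: w]) S g := by
  have hb : b.toNat < 2 := Bool.toNat_lt b
  have hold : ∀ u ∈ W, ∀ c < 8, (u ≠ w ∨ c ≠ 6 + b.toNat) →
      g (addr n W u + c) = f (addr n W u + c) := by
    intro u hu c hc hne
    have h1 := le_addr (n := n) (W := W) u
    have h2 := addr_lt (n := n) hu
    refine hg _ (by omega) (by omega) (by omega) ?_ (by omega) (by omega) (by omega)
    rcases hne with hne | hne
    · exact addr_add_ne hu hne hc (by omega)
    · exact addr_add_ne_of_ne hne hc (by omega)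
  have hreg : ∀ a < 16, a ≠ 2 → a ≠ 8 → a ≠ 12 → g a = f a := by
    intro a ha h2 h8 h12
    have h1 := le_addr (n := n) (W := W) w
    exact hg _ h2 h8 h12 (by omega) (by omega) (by omega) (by omega)
  have hnew : ∀ c, c ≠ 0 → c ≠ 1 → c ≠ 4 → g (p + c) = 0 := by
    intro c h0 h1 h4
    have h2 := addr_lt (n := n) hw
    have h3 := le_addr (n := n) (W := W) w
    rw [hg _ (by omega) (by omega) (by omega) (by omega) (by omega) (by omega) (by omega)]
    exact h.fresh _ (by omega)
  have hself : addr n (W ++ [b :: w]) (b :: w) = p := by rw [addr_append_self hbw, hp]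
  have hcases : ∀ u ∈ W ++ [b :: w], u ∈ W ∨ u = b :: w := by simp
  have hnil := h.trie.nil
  refine ⟨⟨by simp [hnil], ?_⟩, ⟨?_, ?_, ?_, ?_, ?_, ?_, ?_, ?_⟩, ?_, ?_, ?_, ?_, ?_, ?_, ?_, ?_, ?_,
    ?_, h.nodup, ?_⟩
  · intro c u hu
    rcases hcases _ hu with hu | hu
    · exact List.mem_append_left _ (h.trie.parent c u hu)
    · obtain ⟨rfl, rfl⟩ := List.cons.inj hu
      exact List.mem_append_left _ hw
  · rw [hreg 0 (by omega) (by omega) (by omega) (by omega), h.static.zero]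
  · rw [hreg 1 (by omega) (by omega) (by omega) (by omega), h.static.one]
  · rw [hreg 4 (by omega) (by omega) (by omega) (by omega), h.static.first]
  · rw [hreg 5 (by omega) (by omega) (by omega) (by omega), h.static.last]
  · rw [addr_append _ hnil]
    exact (hold [] hnil 0 (by omega) (Or.inr (by omega))).trans h.static.root
  · intro c u hu
    rcases hcases _ hu with hu | hu
    · rw [addr_append _ hu, addr_append _ (h.trie.parent c u hu)]
      exact (hold _ hu 0 (by omega) (Or.inr (by omega))).trans (h.static.parent c u hu)
    · obtain ⟨rfl, rfl⟩ := List.cons.inj hu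
      rw [hself, addr_append _ hw, hparent]
  · intro c u hu
    rcases hcases _ hu with hu | hu
    · rw [addr_append _ hu]
      exact (hold _ hu 1 (by omega) (Or.inr (by omega))).trans (h.static.letter c u hu)
    · obtain ⟨rfl, rfl⟩ := List.cons.inj hu
      rw [hself, hletter]
  · intro c u hu
    rcases hcases _ hu with hu | hu
    · rw [addr_append _ hu]
      exact (hold _ hu 4 (by omega) (Or.inr (by omega))).trans (h.static.var c u hu)
    · obtain ⟨rfl, rfl⟩ := List.cons.inj hu
      rw [hself, hvar]
  · rw [hreg 6 (by omega) (by omega) (by omega) (by omega), h.four]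
  · rw [hreg 7 (by omega) (by omega) (by omega) (by omega), h.rootReg]
  · rw [hfree, hp, List.length_append, List.length_singleton]; ring
  · rw [hreg 13 (by omega) (by omega) (by omega) (by omega), h.head,
      headAddr_append _ fun w hw => (h.mem w hw).1]
  · rw [addr_append _ hnil, h.nil]
  · intro u hu c
    have hc : c.toNat < 2 := Bool.toNat_lt c
    rcases hcases _ hu with hu | rfl
    · rw [addr_append _ hu]
      by_cases he : c :: u = b :: w
      · obtain ⟨rfl, rfl⟩ := List.cons.inj he
        rw [hchild, if_pos (by simp), hself]
      · rw [hold _ hu _ (by omega), h.child u hu c]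
        · by_cases hcu : c :: u ∈ W
          · rw [if_pos hcu, if_pos (by simp [hcu]), addr_append _ hcu]
          · rw [if_neg hcu, if_neg (by simpa [hcu] using he)]
        · by_contra hcon
          push Not at hcon
          refine he ?_
          rw [hcon.1]
          have : c.toNat = b.toNat := by omega
          cases b <;> cases c <;> simp_all
    · rw [hself, hnew _ (by omega) (by omega) (by omega), if_neg]
      intro hmem
      rcases hcases _ hmem with hmem | hmem
      · exact hbw (h.trie.parent _ _ hmem)
      · have := congrArg List.length hmem
        simp at this
  · intro u hu
    rcases hcases _ hu with hu | rfl
    · rw [addr_append _ hu, hold _ hu _ (by omega) (Or.inr (by omega)), h.mark u hu]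
    · rw [hself, hnew _ (by omega) (by omega) (by omega)]
  · intro u hu
    rcases hcases _ hu with hu | rfl
    · rw [addr_append _ hu, hold _ hu _ (by omega) (Or.inr (by omega)), h.back u hu]
    · rw [hself, hnew _ (by omega) (by omega) (by omega)]
  · intro a ha
    rw [List.length_append, List.length_singleton] at ha
    obtain ⟨c, rfl⟩ := Nat.exists_eq_add_of_le (show p ≤ a by omega)
    exact hnew c (by omega) (by omega) (by omega)
  · refine IsChain.append _ (fun w hw => (h.mem w hw).1) (h.chain.congr fun u hu =>
      hold _ (h.mem u hu).1 _ (by omega) (Or.inr (by omega)))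
  · intro u hu
    exact ⟨List.mem_append_left _ (h.mem u hu).1, (h.mem u hu).2⟩

/-- The two child pointers are adjacent: the letter is added to the node address and the
displacement 6 does the rest. A pointer 0 means that the child is missing. -/
theorem insert_letter (h : Build n W S f) (hw : w ∈ W) (h9 : f 9 = addr n W w)
    (h10 : f 10 = 16 + w.length) :
    Within prog 18 ⟨18, f, letter b :: inp, out⟩ fun s => ∃ g W', s = ⟨16, g, inp, out⟩ ∧
      Build n W' S g ∧ b :: w ∈ W' ∧ g 9 = addr n W' (b :: w) ∧ g 10 = 16 + (b :: w).length := by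
  have hb : b.toNat < 2 := Bool.toNat_lt b
  -- Common end, once register 12 holds the child, whether found or created.
  have last : ∀ g W', Build n W' S g → b :: w ∈ W' → g 12 = addr n W' (b :: w) →
      g 10 = 16 + w.length → Within prog 4 ⟨32, g, inp, out⟩ fun s => ∃ g W',
        s = ⟨16, g, inp, out⟩ ∧ Build n W' S g ∧ b :: w ∈ W' ∧ g 9 = addr n W' (b :: w) ∧
        g 10 = 16 + (b :: w).length := by
    intro g W' hg hbw h12 h10
    refine Within.copy rfl h12 ?_
    refine Within.const rfl ?_
    refine Within.add (v := 16 + w.length + 1) rfl (by simp [h10]) ?_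
    refine Within.jump rfl le_rfl (Within.done ⟨_, W', rfl,
      ((hg.update _ (by omega)).update _ (by omega)).update _ (by omega), hbw, by simp, ?_⟩)
    simp [add_assoc]
  -- Common continuation of the two letters, once register 11 accounts for the choice of child.
  have main : ∀ g, Build n W S g → g 9 = addr n W w → g 10 = 16 + w.length → g 3 = letter b →
      g 11 = addr n W w + b.toNat → Within prog 13 ⟨23, g, inp, out⟩ fun s => ∃ g W',
        s = ⟨16, g, inp, out⟩ ∧ Build n W' S g ∧ b :: w ∈ W' ∧ g 9 = addr n W' (b :: w) ∧
        g 10 = 16 + (b :: w).length := by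
    intro g hg h9 h10 h3 h11
    refine Within.load (v := if b :: w ∈ W then addr n W (b :: w) else 0) rfl h11
      (by rw [add_assoc, add_comm b.toNat]; exact hg.child w hw b) ?_
    by_cases hbw : b :: w ∈ W
    · simp only [if_pos hbw]
      have := le_addr (n := n) (W := W) (b :: w)
      refine Within.jump rfl (by simp [hg.static.one]; omega) ?_
      exact (last _ W (hg.update _ (by omega)) hbw (by simp) (by simpa using h10)).le (by omega)
    · simp only [if_neg hbw]
      refine Within.noJump rfl (by simp [hg.static.one]) ?_
      have hp := addr_lt (n := n) hw
      have hp' := le_addr (n := n) (W := W) w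
      set p := 16 + n + 8 * W.length with hpdef
      refine Within.copy (v := p) rfl (by simpa using hg.free) ?_
      rw [Function.update_idem]
      refine Within.store (v := p) rfl (by simpa using h11) (by simp) ?_
      refine Within.store (a := p) (v := addr n W w) rfl
        (by rw [Function.update_of_ne (by omega)]; simp)
        (by rw [Function.update_of_ne (by omega)]; simpa using h9) ?_
      refine Within.store (a := p) (v := letter b) rfl
        (by rw [Function.update_of_ne (by omega), Function.update_of_ne (by omega)]; simp)
        (by rw [Function.update_of_ne (by omega), Function.update_of_ne (by omega)]
            simpa using h3) ?_
      refine Within.store (a := p) (v := 16 + w.length) rfl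
        (by rw [Function.update_of_ne (by omega), Function.update_of_ne (by omega),
              Function.update_of_ne (by omega)]; simp)
        (by rw [Function.update_of_ne (by omega), Function.update_of_ne (by omega),
              Function.update_of_ne (by omega)]; simpa using h10) ?_
      refine Within.const rfl ?_
      refine Within.add (v := p + 8) rfl
        (by rw [Function.update_of_ne (by omega), Function.update_of_ne (by omega),
              Function.update_of_ne (by omega), Function.update_of_ne (by omega),
              Function.update_of_ne (by omega), Function.update_of_ne (by omega),
              Function.update_self, hg.free]) ?_
      rw [add_zero]
      refine last _ (W ++ [b :: w]) (hg.extend hw hbw hpdef ?_ ?_ ?_ ?_ ?_ ?_) (by simp) ?_ ?_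
      · rw [Function.update_of_ne (by omega), Function.update_of_ne (by omega),
          Function.update_of_ne (by omega), Function.update_of_ne (by omega),
          Function.update_of_ne (by omega), add_comm 6, ← add_assoc, Function.update_self]
      · rw [Function.update_of_ne (by omega), Function.update_of_ne (by omega),
          Function.update_of_ne (by omega), Function.update_of_ne (by omega), Function.update_self]
      · rw [Function.update_of_ne (by omega), Function.update_of_ne (by omega),
          Function.update_of_ne (by omega), Function.update_self]
      · rw [Function.update_of_ne (by omega), Function.update_of_ne (by omega),
          Function.update_self]
      · rw [Function.update_self]
      · intro a _ _ _ _ _ _ _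
        rw [Function.update_of_ne (by omega), Function.update_of_ne (by omega),
          Function.update_of_ne (by omega), Function.update_of_ne (by omega),
          Function.update_of_ne (by omega), Function.update_of_ne (by omega),
          Function.update_of_ne (by omega)]
      · rw [addr_append_self hbw, Function.update_of_ne (by omega),
          Function.update_of_ne (by omega), Function.update_of_ne (by omega),
          Function.update_of_ne (by omega), Function.update_of_ne (by omega),
          Function.update_of_ne (by omega), Function.update_self]
      · rw [Function.update_of_ne (by omega), Function.update_of_ne (by omega),
          Function.update_of_ne (by omega), Function.update_of_ne (by omega),
          Function.update_of_ne (by omega), Function.update_of_ne (by omega),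
          Function.update_of_ne (by omega), h10]
  refine Within.read rfl ?_
  refine Within.copy (v := addr n W w) rfl (by simp [h9]) ?_
  have hB := (h.update (a := 3) (letter b) (by omega)).update (a := 11) (addr n W w) (by omega)
  cases b with
  | false =>
    refine Within.jump rfl (by simp [letter, h.static.one]) ?_
    exact (main _ hB (by simpa using h9) (by simpa using h10) (by simp) (by simp)).le (by omega)
  | true =>
    refine Within.noJump rfl (by simp [letter, h.static.one]) ?_
    refine Within.const rfl ?_
    refine Within.add (v := addr n W w + 1) rfl (by simp [h9]) ?_
    exact (main _ ((hB.update _ (by omega)).update _ (by omega)) (by simpa using h9)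
      (by simpa using h10) (by simp) (by simp)).le (by omega)

/-- Each descent conses a letter onto the node, so the word read appears reversed in the trie. A
letter takes 18 steps and one loop test. -/
theorem insert_word (l : List Bool) :
    ∀ (W : List (List Bool)) (w : List Bool) (f : ℕ → ℕ), Build n W S f → w ∈ W →
      w.length + l.length = n → f 9 = addr n W w → f 10 = 16 + w.length →
      Within prog (19 * l.length + 2) ⟨16, f, l.map letter ++ inp, out⟩ fun s =>
        ∃ g W', s = ⟨36, g, inp, out⟩ ∧ Build n W' S g ∧ l.reverse ++ w ∈ W' ∧
          g 9 = addr n W' (l.reverse ++ w) := by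
  induction l with
  | nil =>
    intro W w f h hw hl h9 h10
    simp only [List.length_nil, add_zero] at hl
    refine Within.noJump rfl (by rw [h.static.last, h10]; omega) ?_
    exact Within.jump rfl le_rfl (Within.done ⟨f, W, rfl, h, hw, h9⟩)
  | cons b l ih =>
    intro W w f h hw hl h9 h10
    rw [List.length_cons] at hl
    refine Within.le (k := 18 + (19 * l.length + 2) + 1) ?_ (by rw [List.length_cons]; omega)
    refine Within.jump rfl (by rw [h.static.last, h10]; omega) ?_
    refine (insert_letter h hw h9 h10).bind ?_
    rintro s ⟨g, W', rfl, h', hbw, h9', h10'⟩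
    have := ih W' (b :: w) g h' hbw (by rw [List.length_cons]; omega) h9' h10'
    simpa using this

/-- The leaf must be new: linking a node twice would overwrite its link and corrupt the list. Hence
the terms must be given without repetition. -/
theorem Build.addLeaf (h : Build n W S f) (hw : w ∈ W) (hl : w.length = n) (hS : w ∉ S) :
    Build n W (w :: S) (Function.update (Function.update f (addr n W w + 2) (headAddr n W S)) 13
      (addr n W w)) := by
  have hw' := le_addr (n := n) (W := W) w
  have hp := addr_lt (n := n) hw
  have hx : ∀ u c, c ≠ 2 → c < 8 → Function.update (Function.update f (addr n W w + 2)
      (headAddr n W S)) 13 (addr n W w) (addr n W u + c) = f (addr n W u + c) := fun u c hc hc' => by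
    have := le_addr (n := n) (W := W) u
    rw [Function.update_of_ne (by omega),
      Function.update_of_ne (addr_add_ne_of_ne hc hc' (by omega))]
  have hr : ∀ a, a ≠ 13 → (a < 16 ∨ 16 + n + 8 * W.length ≤ a) →
      Function.update (Function.update f (addr n W w + 2) (headAddr n W S)) 13 (addr n W w) a
        = f a := fun a ha ha' => by
    rw [Function.update_of_ne ha, Function.update_of_ne (by omega)]
  exact
    { trie := h.trie
      static :=
        { zero := (hr 0 (by omega) (by omega)).trans h.static.zero
          one := (hr 1 (by omega) (by omega)).trans h.static.one
          first := (hr 4 (by omega) (by omega)).trans h.static.first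
          last := (hr 5 (by omega) (by omega)).trans h.static.last
          root := (hx [] 0 (by omega) (by omega)).trans h.static.root
          parent := fun b w hw => (hx _ 0 (by omega) (by omega)).trans (h.static.parent b w hw)
          letter := fun b w hw => (hx _ 1 (by omega) (by omega)).trans (h.static.letter b w hw)
          var := fun b w hw => (hx _ 4 (by omega) (by omega)).trans (h.static.var b w hw) }
      four := (hr 6 (by omega) (by omega)).trans h.four
      rootReg := (hr 7 (by omega) (by omega)).trans h.rootReg
      free := (hr 8 (by omega) (by omega)).trans h.free
      head := by simp [headAddr]
      nil := h.nil
      child := fun w hw b => (hx w _ (by omega) (by have := Bool.toNat_lt b; omega)).trans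
        (h.child w hw b)
      mark := fun w hw => (hx w 3 (by omega) (by omega)).trans (h.mark w hw)
      back := fun w hw => (hx w 5 (by omega) (by omega)).trans (h.back w hw)
      fresh := fun a ha => (hr a (by omega) (by omega)).trans (h.fresh a ha)
      chain := by
        refine ⟨by rw [Function.update_of_ne (by omega), Function.update_self],
          h.chain.congr fun u hu => ?_⟩
        have hne : w ≠ u := by rintro rfl; exact hS hu
        have := le_addr (n := n) (W := W) u
        rw [Function.update_of_ne (by omega),
          Function.update_of_ne (addr_add_ne hw hne (by omega) (by omega)).symm]
      nodup := List.nodup_cons.2 ⟨hS, h.nodup⟩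
      mem := fun u hu => by
        rcases List.mem_cons.1 hu with rfl | hu
        exacts [⟨hw, hl⟩, h.mem u hu] }

/-- The separator of `l` has already been consumed when the loop is entered. The 8 extra steps per
word are resetting, leaving the letter loop, linking the leaf and testing for a further separator.
-/
theorem insert_words (ws : List (List Bool)) :
    ∀ (l : List Bool) (W S : List (List Bool)) (f : ℕ → ℕ), Build n W S f →
      (∀ u ∈ l :: ws, u.length = n ∧ u.reverse ∉ S) → (l :: ws).Nodup →
      Within prog ((19 * n + 8) * (l :: ws).length)
        ⟨14, f, l.map letter ++ ws.flatMap fun l => 4 :: l.map letter, out⟩ fun s =>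
        ∃ g W' S', s = ⟨40, g, [], out⟩ ∧ Build n W' S' g ∧
          ∀ w, w ∈ S' ↔ w ∈ S ∨ w.reverse ∈ l :: ws := by
  induction ws with
  | nil =>
    intro l W S f h hl hnd
    obtain ⟨hln, hlS⟩ := hl l (by simp)
    refine Within.le (k := (19 * l.length + 2) + 4 + 2) ?_ (by simp [hln])
    refine Within.copy (v := addr n W []) rfl (h.rootReg.trans h.nil.symm) ?_
    refine Within.copy (v := 16) rfl (by simpa using h.static.first) ?_
    refine (insert_word (inp := []) l W [] _ ((h.update (a := 9) (addr n W []) (by omega)).update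
      (a := 10) 16 (by omega)) h.trie.nil
      (by simpa using hln) (by simp) (by simp)).bind (l := 4) ?_
    rintro s ⟨g, W', rfl, hg, hmem, h9⟩
    rw [List.append_nil] at hmem h9
    have hlen : 16 ≤ addr n W' l.reverse := (Nat.le_add_right _ _).trans (le_addr _)
    refine Within.store rfl h9 hg.head ?_
    refine Within.copy (v := addr n W' l.reverse) rfl
      (by rw [Function.update_of_ne (by omega), h9]) ?_
    have hB := hg.addLeaf hmem (by simpa using hln) hlS
    refine Within.read rfl ?_
    -- At the end of the input the letter read is 0, below the separator 4.
    refine Within.noJump rfl (by simpa using hB.four.ge.trans_lt' four_pos) (Within.done ⟨_, W', _, rfl,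
      hB.update _ (by omega), fun w => ?_⟩)
    simp only [List.mem_cons, List.not_mem_nil, or_false]
    rw [or_comm, List.reverse_eq_iff]
  | cons l' ws ih =>
    intro l W S f h hl hnd
    obtain ⟨hln, hlS⟩ := hl l (by simp)
    refine Within.le (k := (19 * l.length + 2) + ((19 * n + 8) * (l' :: ws).length + 4) + 2) ?_
      (by simp only [List.length_cons, hln]; ring_nf; omega)
    refine Within.copy (v := addr n W []) rfl (h.rootReg.trans h.nil.symm) ?_
    refine Within.copy (v := 16) rfl (by simpa using h.static.first) ?_
    refine (insert_word l W [] _ ((h.update (a := 9) (addr n W []) (by omega)).update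
      (a := 10) 16 (by omega)) h.trie.nil
      (by simpa using hln) (by simp) (by simp)).bind ?_
    rintro s ⟨g, W', rfl, hg, hmem, h9⟩
    rw [List.append_nil] at hmem h9
    have hlen : 16 ≤ addr n W' l.reverse := (Nat.le_add_right _ _).trans (le_addr _)
    refine Within.store rfl h9 hg.head ?_
    refine Within.copy (v := addr n W' l.reverse) rfl
      (by rw [Function.update_of_ne (by omega), h9]) ?_
    have hB := hg.addLeaf hmem (by simpa using hln) hlS
    refine Within.read rfl ?_
    refine Within.jump rfl (by simpa using hB.four.le) ?_
    have hnd' := List.nodup_cons.1 hnd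
    obtain ⟨t, ht, g', W'', S'', hs, hg', hm⟩ := ih l' W' _ _ (hB.update (a := 3) 4 (by omega))
      (fun u hu => ⟨(hl u (by simp only [List.mem_cons] at hu ⊢; tauto)).1, fun hc => by
        rcases List.mem_cons.1 hc with hc | hc
        · exact hnd'.1 (List.reverse_injective hc ▸ hu)
        · exact (hl u (by simp only [List.mem_cons] at hu ⊢; tauto)).2 hc⟩) hnd'.2
    refine ⟨t, ht, g', W'', S'', hs, hg', fun w => ?_⟩
    rw [hm, List.mem_cons, List.mem_cons (a := w.reverse) (b := l), List.reverse_eq_iff]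
    tauto

/-- The loop that reads `n`. -/
theorem read_unary (m : ℕ) : ∀ (i : ℕ) (f : ℕ → ℕ), f 0 = 0 → f 1 = 1 → f 6 = 4 → f 5 = i →
    Within prog (6 * m) ⟨4, f, List.replicate m 1 ++ inp, out⟩ fun s =>
      ∃ g, s = ⟨4, g, inp, out⟩ ∧ g 5 = i + m ∧
        ∀ a, a ≠ 2 → a ≠ 3 → a ≠ 5 → g a = f a := by
  induction m with
  | zero =>
    intro i f h0 h1 h6 h5
    exact Within.done ⟨f, rfl, h5, fun _ _ _ _ => rfl⟩
  | succ m ih =>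
    intro i f h0 h1 h6 h5
    refine Within.le (k := 6 * m + 6) ?_ (by omega)
    refine Within.read rfl ?_
    refine Within.noJump rfl (by simp [h6, List.replicate_succ]) ?_
    refine Within.noJump rfl (by simp [h0, List.replicate_succ]) ?_
    refine Within.const rfl ?_
    refine Within.add (v := i + 1) rfl (by simp [h5]) ?_
    refine Within.jump rfl le_rfl ?_
    obtain ⟨t, ht, g, hs, h5', hg⟩ := ih (i + 1)
      (Function.update (Function.update (Function.update f 3 1) 2 1) 5 (i + 1)) (by simpa using h0) (by simpa using h1)
      (by simpa using h6) (Function.update_self ..)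
    refine ⟨t, ht, g, hs, by omega, fun a h2 h3 h5 => ?_⟩
    rw [hg a h2 h3 h5, Function.update_of_ne h5, Function.update_of_ne h2, Function.update_of_ne h3]

theorem Build.init (h : ∀ a, a ≠ 1 → a ≠ 2 → a ≠ 3 → a ≠ 4 → a ≠ 5 → a ≠ 6 → a ≠ 7 → a ≠ 8 →
      f a = 0) (h1 : f 1 = 1) (h4 : f 4 = 16) (h5 : f 5 = 15 + n) (h6 : f 6 = 4)
    (h7 : f 7 = 16 + n) (h8 : f 8 = 16 + n + 8) : Build n [[]] [] f := by
  have hz : ∀ a, 9 ≤ a → f a = 0 := fun a ha =>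
    h a (by omega) (by omega) (by omega) (by omega) (by omega) (by omega) (by omega) (by omega)
  have hn : ∀ w c, f (addr n [[]] w + c) = 0 := fun w c => by
    have := le_addr (n := n) (W := [[]]) w
    exact hz _ (by omega)
  refine ⟨⟨by simp, by simp⟩, ⟨h 0 (by omega) (by omega) (by omega) (by omega) (by omega) (by omega)
    (by omega) (by omega), h1, h4, h5, hn [] 0, by simp, by simp, by simp⟩, h6, h7, h8,
    hz 13 (by omega), by simp [addr], ?_, fun w _ => hn w 3, fun w _ => hn w 5,
    fun a ha => hz a (by omega), trivial, List.nodup_nil, by simp⟩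
  intro w hw b
  rw [hn, if_neg (by simp)]

/-- The precomputation phase. -/
theorem construct (ws : List (List Bool)) (hws : ∀ u ∈ ws, u.length = n) (hnd : ws.Nodup) :
    Within prog (20 * (n + ws.length * (n + 1) + 1))
      ⟨0, fun _ => 0, List.replicate n 1 ++ ws.flatMap fun l => 4 :: l.map letter, out⟩ fun s =>
        ∃ g, s = ⟨40, g, [], out⟩ ∧ (ws = [] ∧ g 0 = 0 ∧ g 13 = 0 ∨
          ws ≠ [] ∧ ∃ W S, Build n W S g ∧ ∀ w, w ∈ S ↔ w.reverse ∈ ws) := by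
  refine Within.le (k := 6 * n + ((19 * n + 8) * ws.length + 6) + 4) ?_ (by ring_nf; omega)
  refine Within.const rfl (Within.const rfl (Within.const rfl (Within.const rfl ?_)))
  refine (read_unary n 15 _ (by simp) (by simp) (by simp) (by simp)).bind ?_
  rintro s ⟨f, rfl, h5, hf⟩
  have h0 : f 0 = 0 := by rw [hf 0 (by omega) (by omega) (by omega)]; simp
  have h1 : f 1 = 1 := by rw [hf 1 (by omega) (by omega) (by omega)]; simp
  have h4 : f 4 = 16 := by rw [hf 4 (by omega) (by omega) (by omega)]; simp
  have h6 : f 6 = 4 := by rw [hf 6 (by omega) (by omega) (by omega)]; simp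
  have hz : ∀ a, a ≠ 1 → a ≠ 2 → a ≠ 3 → a ≠ 4 → a ≠ 5 → a ≠ 6 → f a = 0 := by
    intro a h1 h2 h3 h4 h5 h6
    rw [hf a h2 h3 h5, Function.update_of_ne h5, Function.update_of_ne h4,
      Function.update_of_ne h6, Function.update_of_ne h1]
  clear hf
  cases ws with
  | nil =>
    -- Without terms the trie is never built; register 13 is still 0, which makes the enumeration
    -- phase stop at once.
    refine Within.read rfl ?_
    refine Within.noJump rfl (by simp [h6]) ?_
    refine Within.jump rfl (by simp) (Within.done ⟨_, rfl, Or.inl ⟨rfl, by simpa using h0, ?_⟩⟩)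
    simpa using hz 13 (by omega) (by omega) (by omega) (by omega) (by omega) (by omega)
  | cons l ws =>
    refine Within.read rfl ?_
    refine Within.jump rfl (by simp [h6]) ?_
    refine Within.const rfl ?_
    refine Within.add (v := 16 + n) rfl (by simp [h5]; ring) ?_
    refine Within.const rfl ?_
    refine Within.add (v := 16 + n + 8) rfl (by simp) ?_
    have hB : Build n [[]] [] (Function.update (Function.update (Function.update (Function.update
        (Function.update f 3 4) 2 1) 7 (16 + n)) 2 8) 8 (16 + n + 8)) := by
      refine Build.init ?_ (by simpa using h1) (by simpa using h4) (by simpa using h5)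
        (by simpa using h6) (by simp) (by simp)
      intro a p1 p2 p3 p4 p5 p6 p7 p8
      rw [Function.update_of_ne p8, Function.update_of_ne p2, Function.update_of_ne p7,
        Function.update_of_ne p2, Function.update_of_ne p3, hz a p1 p2 p3 p4 p5 p6]
    obtain ⟨t, ht, g, W, S, hs, hB', hm⟩ := insert_words (out := out) ws l _ _ _ hB
      (fun u hu => ⟨hws u hu, by simp⟩) hnd
    exact ⟨t, ht, g, hs, Or.inr ⟨by simp, W, S, hB', fun w => by simpa using hm w⟩⟩

end Construct

/-! ## Correctness of the program -/

section Correct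

variable {n : ℕ}

/-- The enumeration phase. -/
theorem Build.enumerate {W S : List (List Bool)} {f : ℕ → ℕ} {inp : List ℕ}
    {out : List (List ℕ)} (h : Build n W S f) (hS : S ≠ []) :
    ∃ O g, IsModelList S O ∧ Within prog (50 * ((n + 1) * O.length) + 4) ⟨40, f, inp, out⟩
      (· = ⟨81, g, inp, out ++ O.map fun α => (α.map bit).reverse⟩) := by
  have hpos := headAddr_pos (n := n) (W := W) hS
  have hL : Level n W n f S := ⟨hS, h.nodup, h.mem, h.chain⟩
  obtain ⟨O, g, hO, hF, h13, -, hrun⟩ := DNFEnum.enumerate (inp := inp) h.trie n S f out le_rfl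
    h.static hL h.head fun v hv _ => h.mark v hv
  have hst := hF.static le_rfl h.static
  -- Leaves have depth `n`, outside the frame, so the back pointer of the initial list keeps its
  -- initial value 0 and stops the machine.
  have hback : g (headAddr n W S + 5) = 0 := by
    rw [hL.frame_head hF le_rfl le_rfl (by omega)]
    obtain ⟨w, -, hw, -, e⟩ := hL.head_eq
    rw [e, h.back w hw]
  refine ⟨O, Function.update g 13 0, hO, Within.le (k := 50 * ((n + 1) * O.length) + 2 + 1) ?_
    (by omega)⟩
  refine Within.noJump rfl (by rw [h.static.zero, h.head]; omega) ?_
  refine hrun.bind ?_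
  rintro s rfl
  refine Within.load rfl h13 hback ?_
  refine Within.jump rfl (by simp) (Within.done ?_)
  simp [outWord]

/-- The whole run on the input with terms `ws`. -/
theorem run_prog (ws : List (List Bool)) (hws : ∀ u ∈ ws, u.length = n) (hnd : ws.Nodup) :
    ∃ S O g, (∀ w, w ∈ S ↔ w.reverse ∈ ws) ∧ S.Nodup ∧ IsModelList S O ∧
      Within prog (20 * (n + ws.length * (n + 1) + 1))
        ⟨0, fun _ => 0, List.replicate n 1 ++ ws.flatMap fun l => 4 :: l.map letter, []⟩ fun s =>
          s.pc = 40 ∧ s.outputs = [] ∧ Within prog (50 * ((n + 1) * O.length) + 4) s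
            (· = ⟨81, g, [], O.map fun α => (α.map bit).reverse⟩) := by
  obtain ⟨t, ht, f, hs, ⟨rfl, h0, h13⟩ | ⟨hne, W, S, hB, hS⟩⟩ :=
    construct (out := []) ws hws hnd
  · refine ⟨[], [], f, by simp, by simp, ⟨by simp, by simp⟩, t, ht, by rw [hs], by rw [hs], ?_⟩
    rw [hs]
    exact Within.jump rfl (by simp [h13]) (Within.done rfl)
  · have hSne : S ≠ [] := by
      obtain ⟨u, hu⟩ := List.exists_mem_of_ne_nil _ hne
      exact List.ne_nil_of_mem ((hS u.reverse).2 (by simpa using hu))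
    obtain ⟨O, g, hO, hrun⟩ := hB.enumerate (inp := []) (out := []) hSne
    refine ⟨S, O, g, hS, hB.nodup, hO, t, ht, by rw [hs], by rw [hs], ?_⟩
    rw [hs]
    simpa using hrun

/-! ### Monotone terms as Boolean words -/

/-- The characteristic word of a monotone term. -/
def Term.word (T : Term n) : List Bool := List.ofFn fun v : Fin n => decide ((v, true) ∈ T.lits)

theorem IsMonotone.encodeTerm_eq {D : DNF n} (hD : IsMonotone D) {T : Term n} (hT : T ∈ D) :
    encodeTerm T = T.word.map letter := by
  unfold encodeTerm Term.word
  rw [List.map_ofFn]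
  congr 1
  ext v
  have : (v, false) ∉ T.lits := fun h => by simpa using hD T hT _ h
  by_cases h : (v, true) ∈ T.lits <;> simp [h, this, letter]

/-- Without negated literals a term is determined by its set of variables, so distinct terms give
distinct leaves. -/
theorem IsMonotone.word_injOn {D : DNF n} (hD : IsMonotone D) {T T' : Term n} (hT : T ∈ D)
    (hT' : T' ∈ D) (h : T.word = T'.word) : T = T' := by
  have h' := List.ofFn_injective h
  ext ⟨v, b⟩
  cases b with
  | true => simpa using congrFun h' v
  | false =>
    exact iff_of_false (fun h => by simpa using hD T hT _ h) (fun h => by simpa using hD T' hT' _ h)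

theorem IsMonotone.satisfiedBy_iff {D : DNF n} (hD : IsMonotone D) {T : Term n} (hT : T ∈ D)
    (α : Assignment n) : T.SatisfiedBy α ↔ List.Forall₂ (· ≤ ·) T.word (List.ofFn α) := by
  rw [List.forall₂_iff_get]
  simp only [Term.word, List.length_ofFn, true_and, List.get_ofFn]
  constructor
  · intro h i hi _
    change decide (((⟨i, hi⟩ : Fin n), true) ∈ T.lits) ≤ α ⟨i, hi⟩
    by_cases hv : ((⟨i, hi⟩ : Fin n), true) ∈ T.lits
    · rw [show α ⟨i, hi⟩ = true from h _ hv]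
      exact Bool.le_true _
    · simp [hv]
  · rintro h ⟨v, b⟩ hl
    obtain rfl : b = true := hD T hT _ hl
    have hv : decide ((v, true) ∈ T.lits) ≤ α v := h v v.2 v.2
    rw [decide_eq_true hl] at hv
    exact top_le_iff.1 hv

theorem encodeModel_eq (α : Assignment n) : encodeModel α = (List.ofFn α).map bit := by
  unfold encodeModel
  rw [List.map_ofFn]
  rfl

theorem bit_injective : Function.Injective bit := by decide

/-- Nodes and models of the trie are reversed words; reversing both sides preserves the
componentwise order. -/
theorem image_sat_eq {D : DNF n} (hD : IsMonotone D) {S O : List (List Bool)}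
    (hS : ∀ w, w ∈ S ↔ ∃ T ∈ D, T.word = w.reverse) (hO : IsModelList S O) :
    {y | y ∈ O.map fun α => (α.map bit).reverse} = encodeModel '' sat D := by
  ext y
  simp only [List.mem_map, Set.mem_ofPred_eq, Set.mem_image, hO.2, hS]
  constructor
  · rintro ⟨α, ⟨w, ⟨T, hT, hw⟩, h⟩, rfl⟩
    have h' := List.rel_reverse h
    rw [← hw] at h'
    have hl : α.reverse.length = n := by rw [← h'.length_eq, Term.word, List.length_ofFn]
    obtain ⟨β, hβ⟩ : ∃ β : Assignment n, α.reverse = List.ofFn β := by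
      subst hl
      exact ⟨_, (List.ofFn_get _).symm⟩
    rw [hβ] at h'
    refine ⟨β, ⟨T, hT, (hD.satisfiedBy_iff hT β).2 h'⟩, ?_⟩
    rw [encodeModel_eq, ← hβ, List.map_reverse]
  · rintro ⟨β, ⟨T, hT, h⟩, rfl⟩
    refine ⟨(List.ofFn β).reverse, ⟨T.word.reverse, ⟨T, hT, by simp⟩,
      List.rel_reverse ((hD.satisfiedBy_iff hT β).1 h)⟩, ?_⟩
    rw [encodeModel_eq, List.map_reverse, List.reverse_reverse]

theorem enumeratesWithin_prog {D : DNF n} (hD : IsMonotone D) {L : List (Term n)} (hL : L.Nodup)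
    (hLD : ∀ T, T ∈ L ↔ T ∈ D) {K : ℕ} (hK : K = 2000 * 20 ^ 2 * (104 + 1)) :
    EnumeratesWithin prog (encodeDNF L) (encodeModel '' sat D) (K * ((encodeDNF L).length + 1) ^ 2)
      (K * max 1 n) (K * ((encodeDNF L).length + 1) ^ 2) := by
  set ws := L.map Term.word with hws
  have hx : encodeDNF L = List.replicate n 1 ++ ws.flatMap fun l => 4 :: l.map letter := by
    rw [encodeDNF, hws, List.flatMap_map]
    congr 1
    refine List.flatMap_congr fun T hT => ?_
    rw [hD.encodeTerm_eq ((hLD T).1 hT)]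
  have hlen : (encodeDNF L).length = n + ws.length * (n + 1) := by
    rw [encodeDNF, List.length_append, List.length_replicate, List.length_flatMap]
    simp [encodeTerm, hws]
  have hnd : ws.Nodup :=
    hL.map_on fun T hT T' hT' h => hD.word_injOn ((hLD T).1 hT) ((hLD T').1 hT') h
  obtain ⟨S, O, g, hS, hSnd, hO, t₀, ht₀, hpc, hout, t, ht, hend⟩ := run_prog (n := n) ws
    (fun u hu => by
      obtain ⟨T, -, rfl⟩ := List.mem_map.1 hu
      simp [Term.word]) hnd
  rw [← hx, ← toState_run] at hpc hout
  rw [← Function.iterate_add_apply, ← hx, ← toState_run] at hend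
  have hS' : ∀ w, w ∈ S ↔ ∃ T ∈ D, T.word = w.reverse := by
    intro w
    rw [hS, hws, List.mem_map]
    simp only [hLD]
  have hY := image_sat_eq hD hS' hO
  have hend_out : (run prog (encodeDNF L) (t + t₀)).outputs = O.map fun α => (α.map bit).reverse :=
    congrArg State.outputs hend
  have hnodup : (O.map fun α => (α.map bit).reverse).Nodup :=
    hO.1.map (List.reverse_injective.comp (List.map_injective_iff.2 bit_injective))
  have hcard : (encodeModel '' sat D).ncard = O.length := by
    rw [← hY, ← List.coe_toFinset, Set.ncard_coe_finset, List.toFinset_card_of_nodup hnodup,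
      List.length_map]
  -- There are at most as many terms as models, so even reading the input fits in the average delay.
  have hwsO : ws.length ≤ O.length := by
    refine le_trans ?_ (hO.length_le hSnd)
    have : ws ⊆ S.map List.reverse := fun u hu =>
      List.mem_map.2 ⟨u.reverse, (hS _).2 (by simpa using hu), by simp⟩
    simpa using (hnd.subperm this).length_le
  have hprod : ∀ a b : ℕ, a ≤ max 1 n → b ≤ max 1 O.length → a * b ≤ max 1 n * max 1 O.length :=
    fun a b ha hb => Nat.mul_le_mul ha hb
  have hn := le_max_right 1 n
  have h1 := le_max_left 1 n
  have hm := le_max_right 1 O.length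
  have hm1 := le_max_left 1 O.length
  -- From `n + 1 ≤ 2 * max 1 n`, the enumeration takes at most `(100 + 4) * max 1 n * max 1 |O|`
  -- steps, whence 104; the input length plus one needs only a factor 4.
  refine enumeratesWithin_of_steps (p := 40) (A := 20) (C := 104) (t₀ := t₀) (t₁ := t + t₀)
    tame_prog ?_ (by omega) (by omega) ?_ ?_ ?_ ?_ ?_ ?_ ?_ ?_ hK
  · intro c hc
    rw [hx] at hc
    simp only [List.mem_append, List.mem_replicate, List.mem_flatMap, List.mem_cons,
      List.mem_map] at hc
    obtain ⟨-, rfl⟩ | ⟨l, -, rfl | ⟨b, -, rfl⟩⟩ := hc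
    · omega
    · omega
    · cases b <;> simp [letter]
  · exact hpc.ge
  · exact hout
  · have : (run prog (encodeDNF L) (t + t₀)).pc = 81 := congrArg State.pc hend
    rw [Halted, this]
    decide
  · rw [hend_out]; exact hnodup
  · rw [hend_out]; exact hY
  · rw [hlen]; exact ht₀
  · rw [hlen, hcard]
    have e1 := hprod n 1 hn hm1
    have e2 := hprod n ws.length hn (hwsO.trans hm)
    have e3 := hprod 1 ws.length h1 (hwsO.trans hm)
    have e4 := hprod 1 1 h1 hm1
    have : ws.length * (n + 1) = n * ws.length + 1 * ws.length := by ring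
    omega
  · rw [hcard]
    have e1 := hprod n O.length hn hm
    have e2 := hprod 1 O.length h1 hm
    have e3 := hprod 1 1 h1 hm1
    have : (n + 1) * O.length = n * O.length + 1 * O.length := by ring
    omega

end Correct

end DNFEnum

theorem mainTheorem8 :
    ∃ (P : DNFEnum.Program) (C k : ℕ),
      ∀ (n : ℕ) (D : DNFEnum.DNF n), DNFEnum.IsMonotone D →
        ∀ L : List (DNFEnum.Term n), L.Nodup → (∀ T, T ∈ L ↔ T ∈ D) →
          DNFEnum.EnumeratesWithin P (DNFEnum.encodeDNF L)
            (DNFEnum.encodeModel '' DNFEnum.sat D)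
            (C * ((DNFEnum.encodeDNF L).length + 1) ^ k)
            (C * max 1 n)
            (C * ((DNFEnum.encodeDNF L).length + 1) ^ k) :=
  ⟨DNFEnum.prog, _, 2, fun _ _ hD _ hL hLD => DNFEnum.enumeratesWithin_prog hD hL hLD rfl⟩
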